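/- There is an absolute constant $c>0$ such that the following holds for all integers $d\ge 1$, $n$ and all $\delta>0$. **Setting.** Let $\sigma(x)=(\sigma_1(x_1),\dots,\sigma_d(x_d))$ where each $\sigma_j:\mathbb R\to\mathbb R$ is known, non-decreasing, $1$-Lipschitz and $\sigma_j(0)=0$. Let $\Theta^\star\in\mathbb R^{d\times d}$ with $\|\Theta^\star\|_F\le W$, and suppose there are a diagonal matrix $K\succeq I$ and $0\le\rho<1$ with $\Theta^{\star\top}K\Theta^\star\preceq\rho K$. Let $\varepsilon_0,\dots,\varepsilon_n$ be independent random vectors in $\mathbb R^d$ with $\mathbb E\,\varepsilon_i=0$, $\mathbb E\,\varepsilon_i\varepsilon_i^\top=I$ and $\sup_{\|\theta\|=1}\sup_{p\ge1}p^{-1/2}(\mathbb E|\langle\varepsilon_i,\theta\rangle|^p)^{1/p}\le\tau$. One observes the trajectory $x_0=0$, $x_{i+1}=\sigma(\Theta^\star x_i)+\varepsilon_i$ for $0\le i\le n$. Put $R=\mathrm{tr}(K)/(1-\rho)$ and $B=4R$, let $\sigma_{\max}(K)$ be the largest singular value of $K$, and let $\mathcal E(\Theta)=\frac1n\sum_{i=1}^n\|\sigma(\Theta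 x_i)-\sigma(\Theta^\star x_i)\|^2$. **Algorithm.** $\widehat\Theta^{(1)}=0$ and $\widehat\Theta^{(t+1)}=\mathrm{Proj}_{\{\|\Theta\|_F\le W\}}\big(\widehat\Theta^{(t)}-\eta_t\cdot\frac1n\sum_{i=1}^n(\sigma(\widehat\Theta^{(t)}x_i)-x_{i+1})x_i^\top\big)$, where the projection is Euclidean (Frobenius). With $m\ge1$ iterations, Option I returns $\widehat\Theta=\widehat\Theta^{(m)}$, and Option II returns $\widehat\Theta=\widehat\Theta^{(t)}$ with $t$ uniform on $\{1,\dots,m\}$; $\mathbb E_{\mathcal A}$ is the expectation over this choice of $t$ only. **Claim.** Suppose $n\ge c\,\frac{\tau^4d}{1-\rho}\log(R/\delta+1)$. 1. (Slow rate.) If $\eta_t=\frac1{16R}$ and $m\ge C_0\sqrt n$, then with probability at least $1-\delta$ Option II satisfies $$\mathbb E_{\mathcal A}[\mathcal E(\widehat\Theta)]\le C_1\sqrt{\tfrac{d^2}{n}\log(4R/\delta+1)},$$ where $C_0=c\,WB\,(\tau^2dR\log(4R/\delta+1))^{-1/2}$ and $C_1=c\,\tau W\sqrt{\sigma_{\max}(K)/(1-\rho)}$.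 2. (Fast rate.) Suppose in addition that, for some $\zeta>0$, $|\sigma_j(a)-\sigma_j(b)|\ge\zeta|a-b|$ for all $j$ and all $a,b\in\mathbb R$. If $\eta_t=\frac{\zeta^2}{(16R)^2}$ and $m\ge C_2\log\big(1+\frac{nW^2B^2}{\tau^2R}\big)$, then with probability at least $1-\delta$ Option I satisfies both $$\mathcal E(\widehat\Theta)\le C_3\,\tfrac{d^2}{n}\log(4R/\delta+1)\quad\text{and}\quad\|\widehat\Theta-\Theta^\star\|_F^2\le C_4\,\tfrac{d^2}{n}\log(4R/\delta+1),$$ where $C_2=c\,B^2\zeta^{-4}$, $C_3=c\,\tau^2B^2\zeta^{-6}\frac{\sigma_{\max}(K)}{1-\rho}$ and $C_4=c\,\tau^2\zeta^{-4}\frac{\sigma_{\max}(K)}{1-\rho}$. -/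

import Mathlib

open MeasureTheory ProbabilityTheory
open scoped Matrix Matrix.Norms.Frobenius

noncomputable section

/-- `ℝᵈ` with the Euclidean norm. -/
abbrev Vec (d : ℕ) : Type := EuclideanSpace ℝ (Fin d)

/-- Real `d × d` matrices; `‖A‖` is the Frobenius norm of `A`. -/
abbrev Mat (d : ℕ) : Type := Matrix (Fin d) (Fin d) ℝ

/-- The map `x ↦ σ (Θ x)`, where `σ` acts coordinatewise through the functions `σ j`. -/
def glm {d : ℕ} (σ : Fin d → ℝ → ℝ) (Θ : Mat d) (x : Vec d) : Vec d :=
  WithLp.toLp 2 (fun j => σ j ((Θ *ᵥ x.ofLp) j))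

/-- The trajectory of `x (i + 1) = f (x i) + ε i` started from `x 0 = 0`. -/
def trajectory {d : ℕ} (f : Vec d → Vec d) (ε : ℕ → Vec d) : ℕ → Vec d
  | 0 => 0
  | i + 1 => f (trajectory f ε i) + ε i

/-- Subgaussian random vectors with variance proxy `τ ^ 2`: the mean is zero and
`p ^ (-1/2) * (𝔼 |⟨v, θ⟩| ^ p) ^ (1/p) ≤ τ` for all unit vectors `θ` and all real `p ≥ 1`. -/
def IsSubG {Ω : Type*} [MeasurableSpace Ω] (P : Measure Ω) {d : ℕ} (v : Ω → Vec d) (τ : ℝ) :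
    Prop :=
  (∫ ω, v ω ∂P) = 0 ∧
    ∀ θ : Vec d, ‖θ‖ = 1 → ∀ p : ℝ, 1 ≤ p →
      eLpNorm (fun ω => inner ℝ (v ω) θ) (ENNReal.ofReal p) P ≤ ENNReal.ofReal (τ * √p)

/-- The noise variables `ε 0, …, ε n` are independent, isotropic (mean zero and identity
covariance) and subgaussian with variance proxy `τ ^ 2`. -/
structure IsNoise {Ω : Type*} [MeasurableSpace Ω] (P : Measure Ω) {d : ℕ} (n : ℕ)
    (ε : ℕ → Ω → Vec d) (τ : ℝ) : Prop where
  measurable : ∀ i ≤ n, Measurable (ε i)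
  indep : iIndepFun (fun i : Fin (n + 1) => ε (i : ℕ)) P
  covariance : ∀ i ≤ n, ∀ j k : Fin d, (∫ ω, ε i ω j * ε i ω k ∂P) = (1 : Mat d) j k
  subG : ∀ i ≤ n, IsSubG P (ε i) τ

/-- Each coordinate of the link is non-decreasing, `1`-Lipschitz and vanishes at `0`. -/
structure IsLink {d : ℕ} (σ : Fin d → ℝ → ℝ) : Prop where
  mono : ∀ j, Monotone (σ j)
  lipschitz : ∀ j, LipschitzWith 1 (σ j)
  map_zero : ∀ j, σ j 0 = 0

/-- The diagonal Lyapunov condition `Θᵀ K Θ ≼ ρ K` with `K` diagonal, normalized so that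
`K ≽ I`, and `0 ≤ ρ < 1`. -/
structure IsDiagLyapunov {d : ℕ} (Θ K : Mat d) (ρ : ℝ) : Prop where
  diag : K.IsDiag
  one_le : (K - 1).PosSemidef
  rho_nonneg : 0 ≤ ρ
  rho_lt_one : ρ < 1
  lyapunov : (ρ • K - Θᵀ * K * Θ).PosSemidef

/-- The effective radius `R = tr K / (1 - ρ)`. -/
def effRadius {d : ℕ} (K : Mat d) (ρ : ℝ) : ℝ := K.trace / (1 - ρ)

/-- The largest singular value, i.e. the Euclidean operator norm. -/
def sigmaMax {d : ℕ} (K : Mat d) : ℝ := ‖Matrix.toEuclideanCLM (𝕜 := ℝ) K‖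

/-- Projection onto `S`: a nearest point of `S` to `x` (it is the only one when the norm is
Euclidean and `S` is nonempty, closed and convex). -/
def nearestPoint {E : Type*} [NormedAddCommGroup E] (S : Set E) (x : E) : E :=
  Classical.epsilon (fun p => p ∈ S ∧ ∀ q ∈ S, ‖x - p‖ ≤ ‖x - q‖)

theorem nearestPoint_spec {E : Type*} [NormedAddCommGroup E] [ProperSpace E] {S : Set E}
    (hS : IsClosed S) (hne : S.Nonempty) (x : E) :
    nearestPoint S x ∈ S ∧ ∀ q ∈ S, ‖x - nearestPoint S x‖ ≤ ‖x - q‖ := by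
  obtain ⟨p, hp, h⟩ := hS.exists_infDist_eq_dist hne x
  refine Classical.epsilon_spec (p := fun p => p ∈ S ∧ ∀ q ∈ S, ‖x - p‖ ≤ ‖x - q‖)
    ⟨p, hp, fun q hq => ?_⟩
  rw [← dist_eq_norm, ← dist_eq_norm, ← h]
  exact Metric.infDist_le_dist_of_mem hq

/-- The pseudogradient `(1/n) ∑_{i=1}^n (σ (Θ x_i) - x_{i+1}) x_iᵀ`. -/
def pseudoGrad {d : ℕ} (σ : Fin d → ℝ → ℝ) (n : ℕ) (x : ℕ → Vec d) (Θ : Mat d) : Mat d :=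
  (1 / (n : ℝ)) • ∑ i ∈ Finset.Icc 1 n,
    Matrix.vecMulVec (glm σ Θ (x i) - x (i + 1)).ofLp (x i).ofLp

/-- The iterates `Θ⁽ᵗ⁾`, `t ≥ 1`, of projected pseudogradient descent over the Frobenius ball of
radius `W`, with learning rates `η t` and `Θ⁽¹⁾ = 0` (the index `0` is not used). -/
def glmtron {d : ℕ} (σ : Fin d → ℝ → ℝ) (W : ℝ) (n : ℕ) (η : ℕ → ℝ) (x : ℕ → Vec d) :
    ℕ → Mat d
  | 0 => 0
  | 1 => 0
  | t + 2 =>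
    nearestPoint {Θ : Mat d | ‖Θ‖ ≤ W}
      (glmtron σ W n η x (t + 1) -
        η (t + 1) • pseudoGrad σ n x (glmtron σ W n η x (t + 1)))

/-- The in-sample prediction error `(1/n) ∑_{i=1}^n ‖σ (Θ x_i) - σ (Θ* x_i)‖²`. -/
def predError {d : ℕ} (σ : Fin d → ℝ → ℝ) (Θstar : Mat d) (n : ℕ) (x : ℕ → Vec d)
    (Θ : Mat d) : ℝ :=
  (1 / (n : ℝ)) * ∑ i ∈ Finset.Icc 1 n, ‖glm σ Θ (x i) - glm σ Θstar (x i)‖ ^ 2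

/-- Expected prediction error of the iterate `Θ⁽ᵗ⁾` with `t` uniform on `{1, …, m}`, over the
draw of `t` only. -/
def uniformIterateError {d : ℕ} (σ : Fin d → ℝ → ℝ) (Θstar : Mat d) (W : ℝ) (n : ℕ)
    (η : ℕ → ℝ) (x : ℕ → Vec d) (m : ℕ) : ℝ :=
  (1 / (m : ℝ)) * ∑ t ∈ Finset.Icc 1 m, predError σ Θstar n x (glmtron σ W n η x t)

end

/-! All the randomness enters through one event, `IsRegularTrajectory`, with three parts: the energy
`∑ ‖x i‖²` is at most `8nR`, the correlation `∑ ε_i x_iᵀ` has squared Frobenius norm of order `τ² d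
R n log(R/δ + 1)`, and `∑ ⟨x i, u⟩² ≥ (n/32) ‖u‖²` for every `u`. On this event both rates are
deterministic statements about projected descent.

The event has probability at least `1 - δ` by an exponential supermartingale argument. If `𝔼 exp (Z
y (ε i)) ≤ 1` for every fixed state `y`, then, since `x i` depends only on earlier noise, `exp (∑ Z
(x i) (ε i))` has mean at most `1`, and Markov's inequality gives the tail `exp (-L)`
(`IsNoise.measure_sum_trajectory_ge_le`). Three kinds of `Z` suffice: a linear form minus its
subgaussian compensator, and the upper and lower deviations of squares of the noise. Energy: `V x =
∑ K_jj x_j²` contracts by `ρ` under the noiseless map, and the cross terms are absorbed into `(1 -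
ρ) ∑ V`. Noise correlation: each entry is self-normalized by tuning the linear event over a finite
grid of parameters. Excitation: in a fixed direction, fresh noise contributes about `n` and the
cross term is absorbed by the square of the drift; a net reaches all directions.

For the algorithm, a monotone `1`-Lipschitz link is cocoercive, so the noiseless pseudogradient `G`
satisfies `⟨Θ - Θ*, G⟩ ≥ E` and `‖G‖² ≤ 8RE`, where `E` is the prediction error. With step `s ≤
1/(16R)` each iteration lowers the squared distance to `Θ*` by `sE`, up to noise
(`norm_glmtron_succ_sub_sq_le`). Telescoping gives the slow rate. For an expansive link, excitation
gives `E ≥ (ζ²/32) ‖Θ - Θ*‖²`, hence a geometric contraction and the fast rate. Finally `tr K ≤ d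
σ_max(K)` converts `dR` into `d² σ_max(K)/(1 - ρ)`. -/

/-! ### Exponential moments of a subgaussian scalar. -/

/-- For a centred variable the linear term integrates to zero, so the moment generating function is
controlled by even moments alone. -/
theorem exp_le_add_cosh_two_mul (x : ℝ) : Real.exp x ≤ x + Real.cosh (2 * x) := by
  rw [Real.cosh_eq]
  have h1 := Real.add_one_le_exp (-(2 * x))
  have h2 : Real.exp (2 * x) = Real.exp x ^ 2 := by rw [← Real.exp_nat_mul]; norm_num
  nlinarith [sq_nonneg (Real.exp x - 1)]

theorem exp_le_one_add_add_sq_mul_exp {z : ℝ} (hz : 0 ≤ z) :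
    Real.exp z ≤ 1 + z + z ^ 2 * Real.exp z := by
  have h : Real.exp z - 1 ≤ z * Real.exp z := by
    have h1 := Real.add_one_le_exp (-z)
    have h2 : Real.exp (-z) * Real.exp z = 1 := by rw [← Real.exp_add]; simp
    nlinarith [Real.exp_pos z]
  nlinarith

theorem exp_neg_le_one_sub_add_sq {z : ℝ} (hz : 0 ≤ z) :
    Real.exp (-z) ≤ 1 - z + z ^ 2 := by
  have h1 := Real.add_one_le_exp z
  have h2 : Real.exp (-z) * Real.exp z = 1 := by rw [← Real.exp_add]; simp
  have h3 := Real.exp_pos (-z)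
  have h4 : Real.exp (-z) * (1 + z) ≤ 1 := by nlinarith
  have h5 : 1 ≤ (1 - z + z ^ 2) * (1 + z) := by nlinarith [pow_nonneg hz 3]
  nlinarith

/-- A centred random variable whose even moments are dominated by `(2 k τ ^ 2) ^ k`. -/
structure HasEvenMomentBound {Ω : Type*} [MeasurableSpace Ω] (P : Measure Ω) (X : Ω → ℝ)
    (τ : ℝ) : Prop where
  measurable : Measurable X
  integral_eq_zero : ∫ ω, X ω ∂P = 0
  lintegral_pow_le : ∀ k : ℕ,
    ∫⁻ ω, ENNReal.ofReal (X ω ^ (2 * k)) ∂P ≤ ENNReal.ofReal ((2 * k * τ ^ 2) ^ k)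

theorem lintegral_even_pow_le_of_eLpNorm_le {Ω : Type*} [MeasurableSpace Ω] {P : Measure Ω}
    [IsProbabilityMeasure P] {X : Ω → ℝ} {τ : ℝ} (hτ : 0 ≤ τ)
    (h : ∀ p : ℝ, 1 ≤ p → eLpNorm X (ENNReal.ofReal p) P ≤ ENNReal.ofReal (τ * √p)) (k : ℕ) :
    ∫⁻ ω, ENNReal.ofReal (X ω ^ (2 * k)) ∂P ≤ ENNReal.ofReal ((2 * k * τ ^ 2) ^ k) := by
  rcases Nat.eq_zero_or_pos k with rfl | hk
  · simp
  have hk1 : (1 : ℝ) ≤ k := by exact_mod_cast hk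
  have h2k : (0 : ℝ) < 2 * k := by linarith
  have hp := h (2 * k) (by linarith)
  rw [eLpNorm_eq_lintegral_rpow_enorm_toReal (ENNReal.ofReal_pos.2 h2k).ne' ENNReal.ofReal_ne_top] at hp
  rw [ENNReal.toReal_ofReal h2k.le] at hp
  have hp' := ENNReal.rpow_le_rpow hp h2k.le
  rw [← ENNReal.rpow_mul, one_div_mul_cancel h2k.ne', ENNReal.rpow_one] at hp'
  have e1 : ∀ ω, ENNReal.ofReal (X ω ^ (2 * k)) = ‖X ω‖ₑ ^ (2 * (k : ℝ)) := by
    intro ω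
    rw [show (2 * (k : ℝ)) = ((2 * k : ℕ) : ℝ) by push_cast; ring, ENNReal.rpow_natCast,
      Real.enorm_eq_ofReal_abs, ← ENNReal.ofReal_pow (abs_nonneg _), pow_mul, pow_mul, sq_abs]
  simp_rw [e1]
  refine hp'.trans (le_of_eq ?_)
  rw [show (2 * (k : ℝ)) = ((2 * k : ℕ) : ℝ) by push_cast; ring, ENNReal.rpow_natCast,
    ← ENNReal.ofReal_pow (by positivity), pow_mul, mul_pow, Real.sq_sqrt (by positivity)]
  congr 2
  push_cast; ring

namespace HasEvenMomentBound

variable {Ω : Type*} [MeasurableSpace Ω] {P : Measure Ω} {X : Ω → ℝ} {τ : ℝ}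

/-- Power series in `X²` with nonnegative coefficients are integrated term by term; in `ENNReal`
this needs no prior integrability. -/
theorem lintegral_tsum_le (hX : HasEvenMomentBound P X τ) {a : ℕ → ℝ} (ha : ∀ k, 0 ≤ a k)
    {f : ℝ → ℝ} (hf : ∀ x, HasSum (fun k => a k * x ^ (2 * k)) (f x)) {b : ℕ → ℝ} {s : ℝ}
    (hab : ∀ k, a k * (2 * k * τ ^ 2) ^ k ≤ b k) (hb : HasSum b s) :
    ∫⁻ ω, ENNReal.ofReal (f (X ω)) ∂P ≤ ENNReal.ofReal s := by
  have e : ∀ ω, ENNReal.ofReal (f (X ω)) = ∑' k, ENNReal.ofReal (a k * X ω ^ (2 * k)) := by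
    intro ω
    rw [← (hf (X ω)).tsum_eq, ENNReal.ofReal_tsum_of_nonneg _ (hf _).summable]
    intro k
    have := ha k
    rw [pow_mul]; positivity
  have hb0 : ∀ k, 0 ≤ b k := fun k => le_trans (by have := ha k; positivity) (hab k)
  simp_rw [e]
  rw [lintegral_tsum (fun k => by have := hX.measurable; fun_prop), ← hb.tsum_eq,
    ENNReal.ofReal_tsum_of_nonneg hb0 hb.summable]
  refine ENNReal.tsum_le_tsum fun k => ?_
  simp_rw [ENNReal.ofReal_mul (ha k)]
  rw [lintegral_const_mul _ (by have := hX.measurable; fun_prop)]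
  refine (mul_le_mul_right (hX.lintegral_pow_le k) _).trans ?_
  rw [← ENNReal.ofReal_mul (ha k)]
  exact ENNReal.ofReal_le_ofReal (hab k)

theorem integrable_of_lintegral_lt_top {Y : Ω → ℝ} (hY : Measurable Y) (h0 : ∀ ω, 0 ≤ Y ω)
    {C : ℝ} (h : ∫⁻ ω, ENNReal.ofReal (Y ω) ∂P ≤ ENNReal.ofReal C) : Integrable Y P := by
  refine ⟨hY.aestronglyMeasurable, ?_⟩
  rw [hasFiniteIntegral_iff_ofReal (Filter.Eventually.of_forall h0)]
  exact h.trans_lt ENNReal.ofReal_lt_top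

theorem integral_le_of_lintegral_le {Y : Ω → ℝ} (hY : Measurable Y) (h0 : ∀ ω, 0 ≤ Y ω)
    {C : ℝ} (hC : 0 ≤ C) (h : ∫⁻ ω, ENNReal.ofReal (Y ω) ∂P ≤ ENNReal.ofReal C) :
    ∫ ω, Y ω ∂P ≤ C := by
  rw [integral_eq_lintegral_of_nonneg_ae (Filter.Eventually.of_forall h0)
    hY.aestronglyMeasurable]
  exact ENNReal.toReal_le_of_le_ofReal hC h

theorem lintegral_le_of_integral_le {Y : Ω → ℝ} (hY : Integrable Y P) (h0 : ∀ ω, 0 ≤ Y ω)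
    {C : ℝ} (h : ∫ ω, Y ω ∂P ≤ C) : ∫⁻ ω, ENNReal.ofReal (Y ω) ∂P ≤ ENNReal.ofReal C := by
  rw [← ofReal_integral_eq_lintegral_ofReal hY (Filter.Eventually.of_forall h0)]
  exact ENNReal.ofReal_le_ofReal h

theorem integrable_pow (hX : HasEvenMomentBound P X τ) (k : ℕ) :
    Integrable (fun ω => X ω ^ (2 * k)) P :=
  integrable_of_lintegral_lt_top (by have := hX.measurable; fun_prop)
    (fun ω => by rw [pow_mul]; positivity) (hX.lintegral_pow_le k)

theorem memLp_two (hX : HasEvenMomentBound P X τ) : MemLp X 2 P :=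
  (memLp_two_iff_integrable_sq hX.measurable.aestronglyMeasurable).2 (by
    simpa using hX.integrable_pow 1)

theorem lintegral_cosh_le (hX : HasEvenMomentBound P X τ) (t : ℝ) :
    ∫⁻ ω, ENNReal.ofReal (Real.cosh (t * X ω)) ∂P ≤ ENNReal.ofReal (Real.exp (2 * τ ^ 2 * t ^ 2)) := by
  refine hX.lintegral_tsum_le (a := fun k => t ^ (2 * k) / (2 * k).factorial)
    (f := fun x => Real.cosh (t * x)) (b := fun k => (2 * τ ^ 2 * t ^ 2) ^ k / k.factorial)
    (fun k => by rw [pow_mul]; positivity) (fun x => ?_) (fun k => ?_) ?_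
  · convert Real.hasSum_cosh (t * x) using 2 with k
    rw [mul_pow]; ring
  -- The factor `k ^ k` of the moment bound is paid for by `k! k^k ≤ (2k)!`, leaving the exponential
  -- series.
  · have h1 : ((k.factorial : ℝ) * (k : ℝ) ^ k) ≤ (2 * k).factorial := by
      have : k.factorial * (k + 1) ^ k ≤ (k + k).factorial := Nat.factorial_mul_pow_le_factorial
      rw [← two_mul] at this
      refine le_trans ?_ (by exact_mod_cast this : ((k.factorial * (k + 1) ^ k : ℕ) : ℝ) ≤ _)
      push_cast
      gcongr
      linarith
    have h2 : (0 : ℝ) < k.factorial := by positivity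
    have h3 : (0 : ℝ) < (2 * k).factorial := by positivity
    rw [div_mul_eq_mul_div, div_le_div_iff₀ h3 h2]
    have e1 : t ^ (2 * k) * (2 * k * τ ^ 2) ^ k * k.factorial
        = (2 * τ ^ 2 * t ^ 2) ^ k * (k.factorial * (k : ℝ) ^ k) := by
      rw [pow_mul]; simp only [mul_pow]; ring
    rw [e1]
    gcongr
  · simpa [Real.exp_eq_exp_ℝ] using NormedSpace.expSeries_div_hasSum_exp (2 * τ ^ 2 * t ^ 2)

theorem lintegral_exp_sq_le (hX : HasEvenMomentBound P X τ) {a : ℝ} (ha : 0 ≤ a)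
    (haτ : 24 * τ ^ 2 * a ≤ 1) :
    ∫⁻ ω, ENNReal.ofReal (Real.exp (a * X ω ^ 2)) ∂P ≤ ENNReal.ofReal 2 := by
  refine hX.lintegral_tsum_le (a := fun k => a ^ k / k.factorial)
    (f := fun x => Real.exp (a * x ^ 2)) (b := fun k => (1 / 2) ^ k)
    (fun k => by positivity) (fun x => ?_) (fun k => ?_) hasSum_geometric_two
  · have := NormedSpace.expSeries_div_hasSum_exp (a * x ^ 2)
    rw [← Real.exp_eq_exp_ℝ] at this
    have e : (fun k : ℕ => a ^ k / k.factorial * x ^ (2 * k)) =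
        fun k : ℕ => (a * x ^ 2) ^ k / k.factorial := by
      funext k
      rw [pow_mul, mul_pow]; ring
    rw [e]
    exact this
  · have h1 : ((k : ℝ) ^ k / k.factorial) ≤ 3 ^ k := by
      refine (Real.pow_div_factorial_le_exp _ (Nat.cast_nonneg k) k).trans ?_
      rw [← mul_one (k : ℝ), Real.exp_nat_mul]
      gcongr
      exact Real.exp_one_lt_three.le
    have e1 : a ^ k / k.factorial * (2 * k * τ ^ 2) ^ k
        = (2 * τ ^ 2 * a) ^ k * ((k : ℝ) ^ k / k.factorial) := by
      simp only [mul_pow]; ring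
    rw [e1]
    calc (2 * τ ^ 2 * a) ^ k * ((k : ℝ) ^ k / k.factorial) ≤ (2 * τ ^ 2 * a) ^ k * 3 ^ k := by
          gcongr
      _ = (6 * τ ^ 2 * a) ^ k := by rw [← mul_pow]; ring_nf
      _ ≤ (1 / 2) ^ k := by gcongr; nlinarith [mul_nonneg (sq_nonneg τ) ha]

variable [IsProbabilityMeasure P]

theorem integrable (hX : HasEvenMomentBound P X τ) : Integrable X P :=
  hX.memLp_two.integrable (by norm_num)

/-- Subgaussian moment generating function. -/
theorem lintegral_exp_le (hX : HasEvenMomentBound P X τ) (t : ℝ) :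
    ∫⁻ ω, ENNReal.ofReal (Real.exp (t * X ω - 8 * τ ^ 2 * t ^ 2)) ∂P ≤ 1 := by
  have hm := hX.measurable
  -- The doubled argument in `exp_le_add_cosh_two_mul` turns `2τ²t²` into `8τ²t²`.
  have hcosh := hX.lintegral_cosh_le (2 * t)
  have hc0 : ∀ ω, 0 ≤ Real.cosh (2 * t * X ω) := fun ω => (Real.cosh_pos _).le
  have hint := integrable_of_lintegral_lt_top (P := P)
    (Y := fun ω => Real.cosh (2 * t * X ω)) (by fun_prop) hc0 hcosh
  have hle := integral_le_of_lintegral_le (P := P)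
    (Y := fun ω => Real.cosh (2 * t * X ω)) (by fun_prop) hc0 (Real.exp_pos _).le hcosh
  have hle2 : ∀ ω, Real.exp (t * X ω) ≤ t * X ω + Real.cosh (2 * t * X ω) := by
    intro ω
    have := exp_le_add_cosh_two_mul (t * X ω)
    rwa [← mul_assoc] at this
  have hsum : Integrable (fun ω => t * X ω + Real.cosh (2 * t * X ω)) P :=
    (hX.integrable.const_mul t).add hint
  have hexp : Integrable (fun ω => Real.exp (t * X ω)) P :=
    hsum.mono' (by fun_prop) (Filter.Eventually.of_forall fun ω => by
      rw [Real.norm_eq_abs, abs_of_pos (Real.exp_pos _)]; exact hle2 ω)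
  have h3 : ∫ ω, Real.exp (t * X ω) ∂P ≤ Real.exp (8 * τ ^ 2 * t ^ 2) := by
    refine (integral_mono hexp hsum hle2).trans ?_
    rw [integral_add (hX.integrable.const_mul t) hint, integral_const_mul, hX.integral_eq_zero,
      mul_zero, zero_add]
    refine hle.trans (le_of_eq ?_)
    congr 1; ring
  have h4 := lintegral_le_of_integral_le (P := P) (Y := fun ω => Real.exp (t * X ω -
    8 * τ ^ 2 * t ^ 2)) (C := 1) (by simp_rw [Real.exp_sub]; exact hexp.div_const _)
    (fun ω => (Real.exp_pos _).le) (by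
      simp_rw [Real.exp_sub]
      rw [integral_div, div_le_one (Real.exp_pos _)]
      exact h3)
  simpa using h4

/-- Upper tail of the square of a variable with unit variance. -/
theorem lintegral_exp_mul_sq_le (hX : HasEvenMomentBound P X τ) (hτ : 1 ≤ 2 * τ ^ 2)
    (hvar : ∫ ω, X ω ^ 2 ∂P = 1) {u : ℝ} (hu : 0 ≤ u) (huτ : 9216 * τ ^ 4 * u ≤ 1) :
    ∫⁻ ω, ENNReal.ofReal (Real.exp (u * X ω ^ 2 - 2 * u)) ∂P ≤ 1 := by
  have hm := hX.measurable
  -- `2w` is the largest parameter for which `lintegral_exp_sq_le` applies; it dominates the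
  -- second-order remainder of `exp (u X²)`.
  set w : ℝ := 1 / (48 * τ ^ 2) with hw
  have hτ0 : 0 < τ ^ 2 := by linarith
  have hτne : τ ≠ 0 := fun h => by simp [h] at hτ0
  have hw0 : 0 < w := by positivity
  have hwτ : 48 * τ ^ 2 * w = 1 := by rw [hw]; field_simp
  have hl := hX.lintegral_exp_sq_le (a := 2 * w) (by linarith) (by nlinarith)
  have hint := integrable_of_lintegral_lt_top (P := P)
    (Y := fun ω => Real.exp (2 * w * X ω ^ 2)) (by fun_prop) (fun ω => (Real.exp_pos _).le) hl
  have hle := integral_le_of_lintegral_le (P := P)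
    (Y := fun ω => Real.exp (2 * w * X ω ^ 2)) (by fun_prop) (fun ω => (Real.exp_pos _).le)
    (by norm_num) hl
  have hint2 : Integrable (fun ω => X ω ^ 2) P := by simpa using hX.integrable_pow 1
  have huw : u ≤ w := by
    have h1 : 48 * τ ^ 2 * u ≤ 9216 * τ ^ 4 * u := by
      have : 48 * τ ^ 2 ≤ 9216 * τ ^ 4 := by nlinarith
      gcongr
    by_contra hcon
    push Not at hcon
    nlinarith
  have hpt : ∀ ω, Real.exp (u * X ω ^ 2) ≤
      1 + u * X ω ^ 2 + 2 * (u / w) ^ 2 * Real.exp (2 * w * X ω ^ 2) := by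
    intro ω
    set q := X ω ^ 2 with hq
    have hq0 : 0 ≤ q := sq_nonneg _
    have h1 := exp_le_one_add_add_sq_mul_exp (z := u * q) (by positivity)
    have h2 := Real.quadratic_le_exp_of_nonneg (x := w * q) (by positivity)
    have h3 : (w * q) ^ 2 ≤ 2 * Real.exp (w * q) := by nlinarith [mul_nonneg hw0.le hq0]
    have h4 : Real.exp (u * q) ≤ Real.exp (w * q) := by
      apply Real.exp_le_exp.2; gcongr
    have h5 : Real.exp (2 * w * q) = Real.exp (w * q) * Real.exp (w * q) := by
      rw [← Real.exp_add]; ring_nf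
    have h6 : (u * q) ^ 2 = (u / w) ^ 2 * (w * q) ^ 2 := by field_simp
    have h7 : (u * q) ^ 2 * Real.exp (u * q) ≤ 2 * (u / w) ^ 2 * Real.exp (2 * w * q) := by
      rw [h6, h5]
      calc (u / w) ^ 2 * (w * q) ^ 2 * Real.exp (u * q)
          ≤ (u / w) ^ 2 * (2 * Real.exp (w * q)) * Real.exp (w * q) := by gcongr
        _ = _ := by ring
    linarith
  have hI1 : Integrable (fun ω => 1 + u * X ω ^ 2) P :=
    (integrable_const _).add (hint2.const_mul u)
  have hI2 : Integrable (fun ω => 2 * (u / w) ^ 2 * Real.exp (2 * w * X ω ^ 2)) P :=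
    hint.const_mul _
  have hsum : Integrable (fun ω => 1 + u * X ω ^ 2 +
      2 * (u / w) ^ 2 * Real.exp (2 * w * X ω ^ 2)) P := hI1.add hI2
  have hexp : Integrable (fun ω => Real.exp (u * X ω ^ 2)) P :=
    hsum.mono' (by fun_prop) (Filter.Eventually.of_forall fun ω => by
      rw [Real.norm_eq_abs, abs_of_pos (Real.exp_pos _)]; exact hpt ω)
  have h3 : ∫ ω, Real.exp (u * X ω ^ 2) ∂P ≤ Real.exp (2 * u) := by
    refine (integral_mono hexp hsum hpt).trans ?_
    rw [integral_add hI1 hI2, integral_add (integrable_const _) (hint2.const_mul u),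
      integral_const_mul, integral_const_mul, hvar]
    have huw2 : u / w = 48 * τ ^ 2 * u := by rw [hw]; field_simp
    -- The remainder has mean at most `4 (48τ²u)² = 9216 τ⁴u²`; this fixes the constant in `huτ`.
    have h4 : 2 * (u / w) ^ 2 * 2 ≤ u := by
      rw [huw2]
      nlinarith
    have h5 := Real.add_one_le_exp (2 * u)
    have h6 : 2 * (u / w) ^ 2 * ∫ ω, Real.exp (2 * w * X ω ^ 2) ∂P ≤ 2 * (u / w) ^ 2 * 2 := by
      gcongr
    simp
    linarith
  have h4 := lintegral_le_of_integral_le (P := P) (Y := fun ω => Real.exp (u * X ω ^ 2 - 2 * u))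
    (C := 1) (by simp_rw [Real.exp_sub]; exact hexp.div_const _)
    (fun ω => (Real.exp_pos _).le) (by
      simp_rw [Real.exp_sub]
      rw [integral_div, div_le_one (Real.exp_pos _)]
      exact h3)
  simpa using h4

/-- Lower tail of the square of a variable with unit variance. -/
theorem lintegral_exp_neg_mul_sq_le (hX : HasEvenMomentBound P X τ)
    (hvar : ∫ ω, X ω ^ 2 ∂P = 1) {u : ℝ} (hu : 0 ≤ u) (huτ : 64 * τ ^ 4 * u ≤ 1) :
    ∫⁻ ω, ENNReal.ofReal (Real.exp (-(u * X ω ^ 2) + 3 / 4 * u)) ∂P ≤ 1 := by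
  have hm := hX.measurable
  have hint2 : Integrable (fun ω => X ω ^ 2) P := by simpa using hX.integrable_pow 1
  have hint4 : Integrable (fun ω => X ω ^ 4) P := by simpa using hX.integrable_pow 2
  have h4le : ∫ ω, X ω ^ 4 ∂P ≤ 16 * τ ^ 4 := by
    refine integral_le_of_lintegral_le (by fun_prop) (fun ω => by positivity) (by positivity) ?_
    have := hX.lintegral_pow_le 2
    norm_num at this
    convert this using 2
    ring
  have hI1 : Integrable (fun ω => 1 - u * X ω ^ 2) P :=
    (integrable_const _).sub (hint2.const_mul u)
  have hI2 : Integrable (fun ω => u ^ 2 * X ω ^ 4) P := hint4.const_mul _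
  have hsum : Integrable (fun ω => 1 - u * X ω ^ 2 + u ^ 2 * X ω ^ 4) P := hI1.add hI2
  have hpt : ∀ ω, Real.exp (-(u * X ω ^ 2)) ≤ 1 - u * X ω ^ 2 + u ^ 2 * X ω ^ 4 := by
    intro ω
    have := exp_neg_le_one_sub_add_sq (z := u * X ω ^ 2) (by positivity)
    calc _ ≤ _ := this
      _ = _ := by ring
  have hexp : Integrable (fun ω => Real.exp (-(u * X ω ^ 2))) P :=
    hsum.mono' (by fun_prop) (Filter.Eventually.of_forall fun ω => by
      rw [Real.norm_eq_abs, abs_of_pos (Real.exp_pos _)]; exact hpt ω)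
  have h3 : ∫ ω, Real.exp (-(u * X ω ^ 2)) ∂P ≤ Real.exp (-(3 / 4 * u)) := by
    refine (integral_mono hexp hsum hpt).trans ?_
    rw [integral_add hI1 hI2, integral_sub (integrable_const _) (hint2.const_mul u),
      integral_const_mul, integral_const_mul, hvar]
    have h5 := Real.add_one_le_exp (-(3 / 4 * u))
    -- By `huτ` this is at most `u/4`, which is the loss from `1` to `3/4` in the exponent.
    have h6 : u ^ 2 * ∫ ω, X ω ^ 4 ∂P ≤ u ^ 2 * (16 * τ ^ 4) := by gcongr
    simp
    nlinarith
  have e : ∀ ω, Real.exp (-(u * X ω ^ 2) + 3 / 4 * u)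
      = Real.exp (-(u * X ω ^ 2)) / Real.exp (-(3 / 4 * u)) := by
    intro ω; rw [← Real.exp_sub]; ring_nf
  have h4 := lintegral_le_of_integral_le (P := P)
    (Y := fun ω => Real.exp (-(u * X ω ^ 2) + 3 / 4 * u))
    (C := 1) (by simp_rw [e]; exact hexp.div_const _)
    (fun ω => (Real.exp_pos _).le) (by
      simp_rw [e]
      rw [integral_div, div_le_one (Real.exp_pos _)]
      exact h3)
  simpa using h4

end HasEvenMomentBound

/-! ### Exponential supermartingales along the trajectory. -/

/-- Conditioning by freezing: the joint law is a product, so `V` is integrated first with `U` held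
fixed. -/
theorem lintegral_le_of_indepFun {Ω α β : Type*} [MeasurableSpace Ω] [MeasurableSpace α]
    [MeasurableSpace β] {P : Measure Ω} [IsProbabilityMeasure P] {U : Ω → α} {V : Ω → β}
    (hU : Measurable U) (hV : Measurable V) (hUV : IndepFun U V P) {F : α → β → ENNReal}
    (hF : Measurable (Function.uncurry F)) {g : α → ENNReal}
    (hFg : ∀ u, ∫⁻ ω, F u (V ω) ∂P ≤ g u) :
    ∫⁻ ω, F (U ω) (V ω) ∂P ≤ ∫⁻ ω, g (U ω) ∂P := by
  have h1 : ∫⁻ ω, F (U ω) (V ω) ∂P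
      = ∫⁻ z, Function.uncurry F z ∂(P.map fun ω => (U ω, V ω)) := by
    rw [lintegral_map hF (hU.prodMk hV)]
    rfl
  rw [h1, (indepFun_iff_map_prod_eq_prod_map_map hU.aemeasurable hV.aemeasurable).1 hUV]
  have := Measure.isProbabilityMeasure_map (μ := P) hU.aemeasurable
  have := Measure.isProbabilityMeasure_map (μ := P) hV.aemeasurable
  rw [lintegral_prod _ hF.aemeasurable, lintegral_map (by fun_prop) hU]
  refine lintegral_mono fun ω => ?_
  refine le_trans (le_of_eq ?_) (hFg (U ω))
  rw [lintegral_map (by fun_prop) hV]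
  rfl

/-- The history `h` with all entries from time `i` on replaced by `0`. -/
def truncateAt {d : ℕ} (i : ℕ) (h : ℕ → Vec d) : ℕ → Vec d := fun j => if j < i then h j else 0

/-- The state at time `j` reads only the noise at times before `j`. Hence `x i` is a function of the
truncated history, which is independent of `ε i`. -/
theorem trajectory_truncateAt {d : ℕ} (f : Vec d → Vec d) (h : ℕ → Vec d) {i j : ℕ}
    (hij : j ≤ i) : trajectory f (truncateAt i h) j = trajectory f h j := by
  induction j with
  | zero => rfl
  | succ j ih =>
    have hj : j < i := hij
    simp only [trajectory, ih hj.le]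
    simp [truncateAt, hj]

theorem measurable_trajectory {d : ℕ} {f : Vec d → Vec d} (hf : Measurable f) (i : ℕ) :
    Measurable fun h : ℕ → Vec d => trajectory f h i := by
  induction i with
  | zero => exact measurable_const
  | succ i ih => exact (hf.comp ih).add (measurable_pi_apply i)

namespace IsNoise

variable {Ω : Type*} [MeasurableSpace Ω] {P : Measure Ω} {d n : ℕ} {ε : ℕ → Ω → Vec d} {τ : ℝ}

theorem measurable_past (hε : IsNoise P n ε τ) {i : ℕ} (hi : i ≤ n + 1) :
    Measurable fun ω => truncateAt i (fun j => ε j ω) := by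
  refine measurable_pi_lambda _ fun j => ?_
  unfold truncateAt
  split_ifs with h
  · exact hε.measurable j (by omega)
  · exact measurable_const

theorem measurable_trajectory (hε : IsNoise P n ε τ) {f : Vec d → Vec d} (hf : Measurable f)
    {i : ℕ} (hi : i ≤ n + 1) : Measurable fun ω => trajectory f (fun j => ε j ω) i := by
  have h := (_root_.measurable_trajectory hf i).comp (hε.measurable_past hi)
  simpa only [Function.comp_def, trajectory_truncateAt _ _ le_rfl] using h

theorem indepFun_past (hε : IsNoise P n ε τ) {i : ℕ} (hi : i ≤ n) :
    IndepFun (fun ω => truncateAt i (fun j => ε j ω)) (ε i) P := by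
  classical
  let S : Finset (Fin (n + 1)) := Finset.univ.filter fun j => (j : ℕ) < i
  let T : Finset (Fin (n + 1)) := {⟨i, by omega⟩}
  have hST : Disjoint S T := by
    simp [S, T]
  have h := hε.indep.indepFun_finset S T hST (fun j => hε.measurable j (by omega))
  let φ : (S → Vec d) → ℕ → Vec d := fun u j =>
    if hj : j < i then u ⟨⟨j, by omega⟩, by simp [S, hj]⟩ else 0
  let ψ : (T → Vec d) → Vec d := fun u => u ⟨⟨i, by omega⟩, by simp [T]⟩
  have hφ : Measurable φ := by
    refine measurable_pi_lambda _ fun j => ?_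
    by_cases hj : j < i
    · simp only [φ, hj, dite_true]; exact measurable_pi_apply _
    · simp only [φ, hj, dite_false]; exact measurable_const
  have hψ : Measurable ψ := measurable_pi_apply _
  have h2 := h.comp hφ hψ
  convert h2 using 1
  · funext ω j
    simp only [truncateAt, φ, Function.comp]
    split_ifs <;> rfl
  · rfl

variable [IsProbabilityMeasure P]

/-- Induction on the number of factors: given the past, the last factor integrates to at most `1`
whatever the current state. -/
theorem lintegral_prod_trajectory_le_one (hε : IsNoise P n ε τ) {f : Vec d → Vec d}
    (hf : Measurable f) {F : Vec d → Vec d → ENNReal} (hF : Measurable (Function.uncurry F))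
    (hF1 : ∀ i ≤ n, ∀ y, ∫⁻ ω, F y (ε i ω) ∂P ≤ 1) {N : ℕ} (hN : N ≤ n + 1) :
    ∫⁻ ω, ∏ i ∈ Finset.range N, F (trajectory f (fun j => ε j ω) i) (ε i ω) ∂P ≤ 1 := by
  induction N with
  | zero => simp
  | succ N ih =>
    have hNn : N ≤ n := by omega
    let g : (ℕ → Vec d) → ENNReal := fun u =>
      ∏ i ∈ Finset.range N, F (trajectory f u i) (u i)
    have hg : Measurable g := by
      refine Finset.measurable_prod _ fun i _ => ?_
      exact hF.comp ((_root_.measurable_trajectory hf i).prodMk (measurable_pi_apply i))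
    let G : (ℕ → Vec d) → Vec d → ENNReal := fun u e => g u * F (trajectory f u N) e
    have hG : Measurable (Function.uncurry G) := by
      refine (hg.comp measurable_fst).mul ?_
      exact hF.comp (((_root_.measurable_trajectory hf N).comp measurable_fst).prodMk measurable_snd)
    have hgt : ∀ ω, g (truncateAt N fun j => ε j ω)
        = ∏ i ∈ Finset.range N, F (trajectory f (fun j => ε j ω) i) (ε i ω) := by
      intro ω
      refine Finset.prod_congr rfl fun i hi => ?_
      have hiN := Finset.mem_range.1 hi
      rw [trajectory_truncateAt _ _ hiN.le]
      simp [truncateAt, hiN]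
    have key := lintegral_le_of_indepFun (P := P) (hε.measurable_past (by omega : N ≤ n + 1))
      (hε.measurable N hNn) (hε.indepFun_past hNn) hG (g := g) (fun u => by
        have hFm : Measurable fun ω => F (trajectory f u N) (ε N ω) :=
          hF.comp (measurable_const.prodMk (hε.measurable N hNn))
        simp only [G]
        rw [lintegral_const_mul _ hFm]
        exact mul_le_of_le_one_right' (hF1 N hNn _))
    simp only [G, hgt, trajectory_truncateAt _ _ le_rfl] at key
    simp_rw [Finset.prod_range_succ]
    exact key.trans (ih (by omega))

/-- Exponential supermartingale bound along a trajectory driven by independent noise. -/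
theorem measure_sum_trajectory_ge_le (hε : IsNoise P n ε τ) {f : Vec d → Vec d}
    (hf : Measurable f) {Z : Vec d → Vec d → ℝ} (hZ : Measurable (Function.uncurry Z))
    (hZ1 : ∀ i ≤ n, ∀ y, ∫⁻ ω, ENNReal.ofReal (Real.exp (Z y (ε i ω))) ∂P ≤ 1) {N : ℕ}
    (hN : N ≤ n + 1) (L : ℝ) :
    P {ω | L ≤ ∑ i ∈ Finset.range N, Z (trajectory f (fun j => ε j ω) i) (ε i ω)}
      ≤ ENNReal.ofReal (Real.exp (-L)) := by
  have h1 := hε.lintegral_prod_trajectory_le_one hf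
    (F := fun y e => ENNReal.ofReal (Real.exp (Z y e)))
    (ENNReal.measurable_ofReal.comp (Real.measurable_exp.comp hZ)) hZ1 hN
  have h2 : ∀ ω, ∏ i ∈ Finset.range N,
      ENNReal.ofReal (Real.exp (Z (trajectory f (fun j => ε j ω) i) (ε i ω)))
      = ENNReal.ofReal (Real.exp
        (∑ i ∈ Finset.range N, Z (trajectory f (fun j => ε j ω) i) (ε i ω))) := by
    intro ω
    rw [← ENNReal.ofReal_prod_of_nonneg (fun _ _ => (Real.exp_pos _).le), Real.exp_sum]
  simp_rw [h2] at h1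
  have h3 := mul_meas_ge_le_lintegral₀ (μ := P) (f := fun ω => ENNReal.ofReal (Real.exp
        (∑ i ∈ Finset.range N, Z (trajectory f (fun j => ε j ω) i) (ε i ω)))) (by
      refine Measurable.aemeasurable ?_
      refine ENNReal.measurable_ofReal.comp (Real.measurable_exp.comp ?_)
      refine Finset.measurable_sum _ fun i hi => ?_
      have hi' := Finset.mem_range.1 hi
      exact hZ.comp ((hε.measurable_trajectory hf (by omega)).prodMk
        (hε.measurable i (by omega)))) (ENNReal.ofReal (Real.exp L))
  have h4 : {ω | L ≤ ∑ i ∈ Finset.range N, Z (trajectory f (fun j => ε j ω) i) (ε i ω)}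
      = {ω | ENNReal.ofReal (Real.exp L) ≤ ENNReal.ofReal (Real.exp
        (∑ i ∈ Finset.range N, Z (trajectory f (fun j => ε j ω) i) (ε i ω)))} := by
    ext ω
    simp only [Set.mem_ofPred_eq]
    rw [ENNReal.ofReal_le_ofReal_iff (Real.exp_pos _).le, Real.exp_le_exp]
  rw [h4]
  have h5 : ENNReal.ofReal (Real.exp (-L)) = (ENNReal.ofReal (Real.exp L))⁻¹ := by
    rw [← ENNReal.ofReal_inv_of_pos (Real.exp_pos _), Real.exp_neg]
  rw [h5, ENNReal.le_inv_iff_mul_le, mul_comm]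
  exact h3.trans h1

theorem hasEvenMomentBound_inner (hε : IsNoise P n ε τ) (hτ : 0 ≤ τ)
    {i : ℕ} (hi : i ≤ n) {θ : Vec d} (hθ : ‖θ‖ = 1) :
    HasEvenMomentBound P (fun ω => inner ℝ (ε i ω) θ) τ := by
  have hm := hε.measurable i hi
  have hmom : ∀ θ : Vec d, ‖θ‖ = 1 → ∀ k : ℕ,
      ∫⁻ ω, ENNReal.ofReal (inner ℝ (ε i ω) θ ^ (2 * k)) ∂P
        ≤ ENNReal.ofReal ((2 * k * τ ^ 2) ^ k) := fun θ hθ k =>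
    lintegral_even_pow_le_of_eLpNorm_le hτ ((hε.subG i hi).2 θ hθ) k
  refine ⟨by fun_prop, ?_, hmom θ hθ⟩
  -- Integrability must come first: the Bochner integral of a non-integrable function is `0` by
  -- convention, so a vanishing integral alone says nothing.
  have hint : Integrable (ε i) P := by
    refine Integrable.of_eval_piLp fun j => ?_
    have h1 := hmom (EuclideanSpace.single j 1) (by simp) 1
    have h2 := HasEvenMomentBound.integrable_of_lintegral_lt_top (by fun_prop)
      (fun ω => by rw [pow_mul]; positivity) h1
    simp only [mul_one, EuclideanSpace.inner_single_right, one_mul] at h2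
    refine MemLp.integrable (q := 2) (by norm_num) ((memLp_two_iff_integrable_sq ?_).2 h2)
    exact (by fun_prop : Measurable fun ω => (ε i ω).ofLp j).aestronglyMeasurable
  simp_rw [real_inner_comm θ]
  rw [integral_inner hint, (hε.subG i hi).1, inner_zero_right]

theorem memLp_two_apply (hε : IsNoise P n ε τ) (hτ : 0 ≤ τ) {i : ℕ} (hi : i ≤ n) (j : Fin d) :
    MemLp (fun ω => ε i ω j) 2 P := by
  have h := (hε.hasEvenMomentBound_inner hτ hi
    (θ := EuclideanSpace.single j 1) (by simp)).memLp_two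
  simpa [EuclideanSpace.inner_single_right] using h

theorem integral_inner_sq (hε : IsNoise P n ε τ) (hτ : 0 ≤ τ) {i : ℕ} (hi : i ≤ n) (θ : Vec d) :
    ∫ ω, inner ℝ (ε i ω) θ ^ 2 ∂P = ‖θ‖ ^ 2 := by
  have e : ∀ ω, inner ℝ (ε i ω) θ ^ 2
      = ∑ j, ∑ k, (θ j * θ k) * (ε i ω j * ε i ω k) := by
    intro ω
    rw [sq, PiLp.inner_apply, Finset.sum_mul_sum]
    refine Finset.sum_congr rfl fun j _ => Finset.sum_congr rfl fun k _ => ?_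
    simp
    ring
  have hint : ∀ j k, Integrable (fun ω => ε i ω j * ε i ω k) P := fun j k =>
    (hε.memLp_two_apply hτ hi j).integrable_mul (hε.memLp_two_apply hτ hi k)
  simp_rw [e]
  rw [integral_finsetSum _ fun j _ => integrable_finsetSum _ fun k _ => (hint j k).const_mul _]
  simp_rw [integral_finsetSum _ fun k _ => (hint _ k).const_mul _, integral_const_mul,
    hε.covariance i hi, Matrix.one_apply]
  rw [EuclideanSpace.real_norm_sq_eq]
  simp [sq]

/-- Each coordinate has variance `1`, while the moment bound with `k = 1` allows at most `2τ²`. This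
lower bound on `τ` later lets `τ²` be replaced by `2τ⁴`. -/
theorem pos_and_one_le_two_mul_sq (hε : IsNoise P n ε τ) (hd : 0 < d) : 0 < τ ∧ 1 ≤ 2 * τ ^ 2 := by
  let j : Fin d := ⟨0, hd⟩
  have hθ : ‖(EuclideanSpace.single j 1 : Vec d)‖ = 1 := by simp
  have hpos : 0 < τ := by
    by_contra hcon
    push Not at hcon
    have h := (hε.subG 0 (Nat.zero_le n)).2 _ hθ 1 le_rfl
    rw [ENNReal.ofReal_of_nonpos (mul_nonpos_of_nonpos_of_nonneg hcon (Real.sqrt_nonneg _)),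
      ENNReal.ofReal_one, nonpos_iff_eq_zero, eLpNorm_eq_zero_iff (by
        have := hε.measurable 0 (Nat.zero_le n)
        exact (by fun_prop : Measurable _).aestronglyMeasurable) one_ne_zero] at h
    have h2 := hε.covariance 0 (Nat.zero_le n) j j
    rw [integral_eq_zero_of_ae] at h2
    · simp at h2
    · filter_upwards [h] with ω hω
      simp only [EuclideanSpace.inner_single_right, one_mul, Pi.zero_apply] at hω ⊢
      rw [show (ε 0 ω).ofLp j = 0 by simpa using hω, mul_zero]
  refine ⟨hpos, ?_⟩
  have h1 := (hε.hasEvenMomentBound_inner hpos.le (Nat.zero_le n) hθ)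
  have h2 := h1.lintegral_pow_le 1
  have h3 := hε.integral_inner_sq hpos.le (Nat.zero_le n) (EuclideanSpace.single j 1)
  have h4 := HasEvenMomentBound.integral_le_of_lintegral_le
    (by have := h1.measurable; fun_prop) (fun ω => by rw [pow_mul]; positivity)
    (by positivity) h2
  simp only [mul_one] at h4
  rw [h3, hθ] at h4
  simpa using h4

theorem lintegral_exp_inner_le_one (hε : IsNoise P n ε τ) (hτ : 0 ≤ τ) {i : ℕ} (hi : i ≤ n)
    (w : Vec d) :
    ∫⁻ ω, ENNReal.ofReal (Real.exp (inner ℝ (ε i ω) w - 8 * τ ^ 2 * ‖w‖ ^ 2)) ∂P ≤ 1 := by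
  rcases eq_or_ne w 0 with rfl | hw
  · simp
  have hw' : ‖w‖ ≠ 0 := norm_ne_zero_iff.2 hw
  have h := (hε.hasEvenMomentBound_inner hτ hi (θ := ‖w‖⁻¹ • w) (by
    rw [norm_smul, norm_inv, norm_norm, inv_mul_cancel₀ hw'])).lintegral_exp_le ‖w‖
  simpa only [inner_smul_right, mul_inv_cancel_left₀ hw'] using h

theorem lintegral_exp_neg_inner_sq_le_one (hε : IsNoise P n ε τ) (hτ : 0 ≤ τ) {i : ℕ}
    (hi : i ≤ n) {v : Vec d} (hv : ‖v‖ = 1) {u : ℝ} (hu : 0 ≤ u) (huτ : 64 * τ ^ 4 * u ≤ 1) :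
    ∫⁻ ω, ENNReal.ofReal (Real.exp (-(u * inner ℝ (ε i ω) v ^ 2) + 3 / 4 * u)) ∂P ≤ 1 :=
  (hε.hasEvenMomentBound_inner hτ hi hv).lintegral_exp_neg_mul_sq_le
    (by rw [hε.integral_inner_sq hτ hi, hv, one_pow]) hu huτ

/-- Upper tail of a weighted sum of squared coordinates, by convexity of `exp`. -/
theorem lintegral_exp_weighted_sq_le_one (hε : IsNoise P n ε τ) (hτ : 0 ≤ τ)
    (hτ1 : 1 ≤ 2 * τ ^ 2) {i : ℕ} (hi : i ≤ n) {w : Fin d → ℝ} (hw : ∀ j, 0 ≤ w j)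
    (hw1 : ∑ j, w j = 1) {u : ℝ} (hu : 0 ≤ u) (huτ : 9216 * τ ^ 4 * u ≤ 1) :
    ∫⁻ ω, ENNReal.ofReal (Real.exp (u * ∑ j, w j * ε i ω j ^ 2 - 2 * u)) ∂P ≤ 1 := by
  have hm := hε.measurable i hi
  have hj : ∀ j, ∫⁻ ω, ENNReal.ofReal (Real.exp (u * ε i ω j ^ 2 - 2 * u)) ∂P ≤ 1 := by
    intro j
    have hθ : ‖(EuclideanSpace.single j 1 : Vec d)‖ = 1 := by simp
    have := (hε.hasEvenMomentBound_inner hτ hi hθ).lintegral_exp_mul_sq_le hτ1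
      (by rw [hε.integral_inner_sq hτ hi, hθ, one_pow]) hu huτ
    simpa [EuclideanSpace.inner_single_right] using this
  have hpt : ∀ ω, ENNReal.ofReal (Real.exp (u * ∑ j, w j * ε i ω j ^ 2 - 2 * u))
      ≤ ∑ j, ENNReal.ofReal (w j) * ENNReal.ofReal (Real.exp (u * ε i ω j ^ 2 - 2 * u)) := by
    intro ω
    simp_rw [← ENNReal.ofReal_mul (hw _)]
    rw [← ENNReal.ofReal_sum_of_nonneg fun j _ => mul_nonneg (hw j) (Real.exp_pos _).le]
    refine ENNReal.ofReal_le_ofReal ?_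
    have := convexOn_exp.map_sum_le (t := Finset.univ) (w := w)
      (p := fun j => u * ε i ω j ^ 2 - 2 * u) (fun j _ => hw j) hw1 (fun _ _ => Set.mem_univ _)
    simp only [smul_eq_mul] at this
    refine le_trans (le_of_eq ?_) this
    congr 1
    simp_rw [mul_sub]
    rw [Finset.sum_sub_distrib, ← Finset.sum_mul, hw1, Finset.mul_sum, one_mul]
    congr 1
    exact Finset.sum_congr rfl fun j _ => by ring
  refine (lintegral_mono hpt).trans ?_
  rw [lintegral_finsetSum _ fun j _ => by fun_prop]
  calc _ ≤ ∑ j, ENNReal.ofReal (w j) := by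
        refine Finset.sum_le_sum fun j _ => ?_
        rw [lintegral_const_mul _ (by fun_prop)]
        exact mul_le_of_le_one_right' (hj j)
    _ = 1 := by
        rw [← ENNReal.ofReal_sum_of_nonneg fun j _ => hw j, hw1, ENNReal.ofReal_one]

end IsNoise

/-! ### The link, the Lyapunov weights and the energy bound. -/

theorem sum_Icc_one_eq_sum_range {M : Type*} [AddCommMonoid M] (g : ℕ → M) (n : ℕ) :
    ∑ i ∈ Finset.Icc 1 n, g i = ∑ i ∈ Finset.range n, g (i + 1) := by
  induction n with
  | zero => simp
  | succ n ih => rw [Finset.sum_Icc_succ_top (by omega), ih, Finset.sum_range_succ]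

theorem measurable_glm {d : ℕ} {σ : Fin d → ℝ → ℝ} (hσ : IsLink σ) (Θ : Mat d) :
    Measurable (glm σ Θ) := by
  have hc : Continuous (glm σ Θ) := by
    unfold glm
    refine (PiLp.continuous_toLp 2 _).comp (continuous_pi fun j => ?_)
    refine (hσ.lipschitz j).continuous.comp ?_
    exact (continuous_apply j).comp ((Continuous.matrix_mulVec continuous_const
      (PiLp.continuous_ofLp 2 _)))
  exact hc.measurable

namespace IsLink

variable {d : ℕ} {σ : Fin d → ℝ → ℝ}

theorem abs_sub_le (hσ : IsLink σ) (j : Fin d) (a b : ℝ) : |σ j a - σ j b| ≤ |a - b| := by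
  simpa [Real.dist_eq] using (hσ.lipschitz j).dist_le_mul a b

theorem sq_le_sq (hσ : IsLink σ) (j : Fin d) (a : ℝ) : σ j a ^ 2 ≤ a ^ 2 := by
  rw [_root_.sq_le_sq]
  simpa [hσ.map_zero j] using hσ.abs_sub_le j a 0

/-- Monotone `1`-Lipschitz functions are cocoercive. -/
theorem sq_sub_le_mul (hσ : IsLink σ) (j : Fin d) (a b : ℝ) :
    (σ j a - σ j b) ^ 2 ≤ (σ j a - σ j b) * (a - b) := by
  have h := hσ.abs_sub_le j a b
  rcases le_total a b with hab | hab
  · have hm := hσ.mono j hab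
    rw [abs_of_nonpos (by linarith), abs_of_nonpos (by linarith)] at h
    nlinarith
  · have hm := hσ.mono j hab
    rw [abs_of_nonneg (by linarith), abs_of_nonneg (by linarith)] at h
    nlinarith

end IsLink

theorem trace_le_card_mul_sigmaMax {d : ℕ} (K : Mat d) : K.trace ≤ d * sigmaMax K := by
  have h1 : ∀ j, K j j ≤ sigmaMax K := by
    intro j
    have h2 := (Matrix.toEuclideanCLM (𝕜 := ℝ) K).le_opNorm (EuclideanSpace.single j 1)
    rw [PiLp.norm_single, norm_one, mul_one] at h2
    refine le_trans ?_ h2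
    refine le_trans ?_ (PiLp.norm_apply_le _ j)
    have : (Matrix.toEuclideanCLM (𝕜 := ℝ) K (EuclideanSpace.single j 1)) j = K j j := by
      simp [Matrix.ofLp_toEuclideanCLM]
    rw [this]
    exact Real.le_norm_self _
  calc K.trace ≤ ∑ _j : Fin d, sigmaMax K := Finset.sum_le_sum fun j _ => h1 j
    _ = d * sigmaMax K := by simp

namespace IsDiagLyapunov

variable {d : ℕ} {σ : Fin d → ℝ → ℝ} {Θ K : Mat d} {ρ : ℝ}

theorem one_le_apply (h : IsDiagLyapunov Θ K ρ) (j : Fin d) : 1 ≤ K j j := by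
  have := h.one_le.diag_nonneg (i := j)
  simpa using this

theorem card_le_trace (h : IsDiagLyapunov Θ K ρ) : (d : ℝ) ≤ K.trace := by
  calc (d : ℝ) = ∑ _j : Fin d, (1 : ℝ) := by simp
    _ ≤ K.trace := Finset.sum_le_sum fun j _ => h.one_le_apply j

theorem apply_le_trace (h : IsDiagLyapunov Θ K ρ) (j : Fin d) : K j j ≤ K.trace :=
  Finset.single_le_sum (f := fun j => K j j)
    (fun j _ => zero_le_one.trans (h.one_le_apply j)) (Finset.mem_univ j)

theorem weighted_sq_mulVec_le (h : IsDiagLyapunov Θ K ρ) (y : Fin d → ℝ) :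
    ∑ j, K j j * (Θ *ᵥ y) j ^ 2 ≤ ρ * ∑ j, K j j * y j ^ 2 := by
  have hK : K = Matrix.diagonal fun j => K j j := h.diag.diagonal_diag.symm
  have h1 := h.lyapunov.dotProduct_mulVec_nonneg y
  have e : ∀ z : Fin d → ℝ, z ⬝ᵥ (K *ᵥ z) = ∑ j, K j j * z j ^ 2 := by
    intro z
    rw [hK]
    simp only [dotProduct, Matrix.mulVec_diagonal, Matrix.diagonal_apply_eq]
    exact Finset.sum_congr rfl fun j _ => by ring
  rw [Matrix.sub_mulVec, dotProduct_sub, Matrix.smul_mulVec, dotProduct_smul, star_trivial, e,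
    ← Matrix.mulVec_mulVec, ← Matrix.mulVec_mulVec, Matrix.dotProduct_mulVec,
    Matrix.vecMul_transpose, e, smul_eq_mul] at h1
  linarith

/-- Diagonality of `K` is what lets the nonlinearity through: the energy is a nonnegative
combination of squared coordinates, and `σ j` shrinks each of them. -/
theorem weighted_sq_glm_le (h : IsDiagLyapunov Θ K ρ) (hσ : IsLink σ) (y : Vec d) :
    ∑ j, K j j * glm σ Θ y j ^ 2 ≤ ρ * ∑ j, K j j * y j ^ 2 := by
  refine le_trans (Finset.sum_le_sum fun j _ => ?_) (h.weighted_sq_mulVec_le y.ofLp)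
  have := h.one_le_apply j
  exact mul_le_mul_of_nonneg_left (hσ.sq_le_sq j _) (by linarith)

theorem card_mul_effRadius_le (h : IsDiagLyapunov Θ K ρ) :
    d * effRadius K ρ ≤ d ^ 2 * (sigmaMax K / (1 - ρ)) := by
  have h1 := h.rho_lt_one
  unfold effRadius
  rw [← mul_div_assoc, ← mul_div_assoc]
  refine div_le_div_of_nonneg_right ?_ (by linarith)
  nlinarith [trace_le_card_mul_sigmaMax K, (Nat.cast_nonneg d : (0 : ℝ) ≤ d)]

theorem trace_le_effRadius (h : IsDiagLyapunov Θ K ρ) : K.trace ≤ effRadius K ρ := by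
  have h1 := h.rho_lt_one
  have h2 := h.rho_nonneg
  have h3 : 0 ≤ K.trace := (Nat.cast_nonneg d).trans h.card_le_trace
  rw [effRadius, le_div_iff₀ (by linarith)]
  nlinarith

end IsDiagLyapunov

/-- The direction `K f` that tests the noise in the energy identity. -/
noncomputable def weightVec {d : ℕ} (K : Mat d) (y : Vec d) : Vec d :=
  WithLp.toLp 2 fun j => K j j * y j

theorem measurable_weightVec {d : ℕ} (K : Mat d) : Measurable (weightVec K) := by
  have : Continuous (weightVec K) := by
    unfold weightVec
    fun_prop
  exact this.measurable

/-- The compensator of the cross term is thereby bounded by the energy itself, which makes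
absorption possible. -/
theorem IsDiagLyapunov.norm_weightVec_sq_le {d : ℕ} {Θ K : Mat d} {ρ : ℝ}
    (h : IsDiagLyapunov Θ K ρ) (y : Vec d) :
    ‖weightVec K y‖ ^ 2 ≤ K.trace * ∑ j, K j j * y j ^ 2 := by
  rw [EuclideanSpace.real_norm_sq_eq, Finset.mul_sum]
  refine Finset.sum_le_sum fun j _ => ?_
  have h1 := h.one_le_apply j
  have h2 := h.apply_le_trace j
  simp only [weightVec, mul_pow]
  have h3 : 0 ≤ K j j * y j ^ 2 := by positivity
  nlinarith

/-- The energy of the trajectory is controlled by the fluctuations of the noise. -/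
theorem sum_norm_sq_trajectory_le {d n : ℕ} {σ : Fin d → ℝ → ℝ} {Θ K : Mat d} {ρ τ L : ℝ}
    (hσ : IsLink σ) (hK : IsDiagLyapunov Θ K ρ) (hd : 0 < d) (hτ : 0 < τ) (e : ℕ → Vec d)
    {lam u : ℝ} (hlam : lam = (1 - ρ) / (64 * τ ^ 2 * K.trace)) (hu : 0 < u)
    (hLu : L ≤ n * u) (hLn : 128 * τ ^ 2 * L ≤ n * (1 - ρ))
    (hcross : ∑ i ∈ Finset.range n,
      (inner ℝ (e i) (lam • weightVec K (glm σ Θ (trajectory (glm σ Θ) e i))) -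
        8 * τ ^ 2 * ‖lam • weightVec K (glm σ Θ (trajectory (glm σ Θ) e i))‖ ^ 2) ≤ L)
    (hnoise : ∑ i ∈ Finset.range n,
      (u * ∑ j, K j j / K.trace * e i j ^ 2 - 2 * u) ≤ L) :
    ∑ i ∈ Finset.Icc 1 n, ‖trajectory (glm σ Θ) e i‖ ^ 2 ≤ 8 * n * effRadius K ρ := by
  set x := trajectory (glm σ Θ) e with hx
  have hρ := hK.rho_lt_one
  have hρ0 := hK.rho_nonneg
  have hT : 0 < K.trace := lt_of_lt_of_le (by exact_mod_cast hd) hK.card_le_trace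
  have hlam0 : 0 < lam := by rw [hlam]; have : 0 < 1 - ρ := by linarith
                             positivity
  set V : ℕ → ℝ := fun i => ∑ j, K j j * x i j ^ 2 with hV
  set F : ℕ → ℝ := fun i => ∑ j, K j j * glm σ Θ (x i) j ^ 2 with hF
  set c : ℕ → ℝ := fun i => inner ℝ (e i) (weightVec K (glm σ Θ (x i))) with hc
  set Y : ℕ → ℝ := fun i => ∑ j, K j j * e i j ^ 2 with hY
  have hKj : ∀ j, 0 ≤ K j j := fun j => zero_le_one.trans (hK.one_le_apply j)
  have hV0 : ∀ i, 0 ≤ V i := fun i => Finset.sum_nonneg fun j _ => by have := hKj j; positivity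
  have hFV : ∀ i, F i ≤ ρ * V i := fun i => hK.weighted_sq_glm_le hσ _
  have hstep : ∀ i, V (i + 1) = F i + 2 * c i + Y i := by
    intro i
    simp only [hV, hF, hc, hY, PiLp.inner_apply, weightVec, Finset.mul_sum]
    rw [← Finset.sum_add_distrib, ← Finset.sum_add_distrib]
    refine Finset.sum_congr rfl fun j _ => ?_
    have : x (i + 1) = glm σ Θ (x i) + e i := rfl
    rw [this]
    simp
    ring
  set S := ∑ i ∈ Finset.range n, V (i + 1) with hS
  -- The shift by one costs nothing because the trajectory starts at `0`.
  have hS0 : ∑ i ∈ Finset.range n, V i ≤ S := by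
    have h1 := Finset.sum_range_succ V n
    have h2 := Finset.sum_range_succ' V n
    have h3 : V 0 = 0 := by simp [hV, hx, trajectory]
    have := hV0 n
    linarith
  have hSpos : 0 ≤ S := Finset.sum_nonneg fun i _ => hV0 _
  have hFS : ∑ i ∈ Finset.range n, F i ≤ ρ * S := by
    calc _ ≤ ∑ i ∈ Finset.range n, ρ * V i := Finset.sum_le_sum fun i _ => hFV i
      _ = ρ * ∑ i ∈ Finset.range n, V i := by rw [Finset.mul_sum]
      _ ≤ ρ * S := by gcongr
  have hYS : ∑ i ∈ Finset.range n, Y i ≤ 3 * n * K.trace := by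
    have e1 : ∑ i ∈ Finset.range n, (u * ∑ j, K j j / K.trace * e i j ^ 2 - 2 * u)
        = u / K.trace * ∑ i ∈ Finset.range n, Y i - 2 * u * n := by
      rw [Finset.sum_sub_distrib, Finset.mul_sum]
      congr 1
      · refine Finset.sum_congr rfl fun i _ => ?_
        simp only [hY, Finset.mul_sum]
        exact Finset.sum_congr rfl fun j _ => by ring
      · simp; ring
    rw [e1] at hnoise
    have h1 : u / K.trace * ∑ i ∈ Finset.range n, Y i ≤ u / K.trace * (3 * n * K.trace) := by
      have : u / K.trace * (3 * n * K.trace) = 3 * n * u := by field_simp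
      rw [this]; linarith
    exact le_of_mul_le_mul_left h1 (by positivity)
  have hcS : lam * ∑ i ∈ Finset.range n, c i ≤ L + 8 * τ ^ 2 * lam ^ 2 * (K.trace * S) := by
    have e1 : ∀ i, lam * c i - 8 * τ ^ 2 * lam ^ 2 * (K.trace * V i) ≤
        inner ℝ (e i) (lam • weightVec K (glm σ Θ (x i))) -
        8 * τ ^ 2 * ‖lam • weightVec K (glm σ Θ (x i))‖ ^ 2 := by
      intro i
      rw [inner_smul_right, norm_smul, mul_pow, Real.norm_eq_abs, sq_abs, ← mul_assoc]
      have h1 := hK.norm_weightVec_sq_le (glm σ Θ (x i))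
      have h2 : K.trace * F i ≤ K.trace * V i := by
        have := hFV i
        have := hV0 i
        gcongr
        nlinarith
      have h3 := mul_le_mul_of_nonneg_left (h1.trans h2)
        (by positivity : 0 ≤ 8 * τ ^ 2 * lam ^ 2)
      linarith
    have h2 := (Finset.sum_le_sum fun i _ => e1 i).trans hcross
    rw [Finset.sum_sub_distrib, ← Finset.mul_sum, ← Finset.mul_sum, ← Finset.mul_sum] at h2
    have h3 : 8 * τ ^ 2 * lam ^ 2 * (K.trace * ∑ i ∈ Finset.range n, V i)
        ≤ 8 * τ ^ 2 * lam ^ 2 * (K.trace * S) := by gcongr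
    linarith
  -- `lam` is chosen so that the compensator, divided by `lam` and doubled, is exactly `(1 - ρ)/4 *
  -- S`; `hLn` bounds the remaining `2L/lam` by `n tr K`.
  have hcS2 : 2 * ∑ i ∈ Finset.range n, c i ≤ n * K.trace + (1 - ρ) / 4 * S := by
    have e1 : lam * (64 * τ ^ 2 * K.trace) = 1 - ρ := by rw [hlam]; field_simp
    refine le_of_mul_le_mul_left (a := lam) ?_ hlam0
    have e2 : lam * (n * K.trace + (1 - ρ) / 4 * S)
      = lam * n * K.trace + lam ^ 2 * (16 * τ ^ 2 * K.trace) * S := by rw [← e1]; ring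
    have e3 : 2 * L ≤ lam * n * K.trace := by
      have : 64 * τ ^ 2 * (2 * L) ≤ 64 * τ ^ 2 * (lam * n * K.trace) := by
        calc _ = 128 * τ ^ 2 * L := by ring
          _ ≤ n * (1 - ρ) := hLn
          _ = _ := by rw [← e1]; ring
      exact le_of_mul_le_mul_left this (by positivity)
    rw [e2]
    linarith
  have hsum : S = ∑ i ∈ Finset.range n, F i + 2 * ∑ i ∈ Finset.range n, c i
      + ∑ i ∈ Finset.range n, Y i := by
    rw [hS, Finset.mul_sum, ← Finset.sum_add_distrib, ← Finset.sum_add_distrib]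
    exact Finset.sum_congr rfl fun i _ => hstep i
  -- Collecting terms gives `(3/4)(1 - ρ) S ≤ 4 n tr K`.
  have hfin : S ≤ 8 * n * effRadius K ρ := by
    rw [effRadius, ← mul_div_assoc, le_div_iff₀ (by linarith)]
    have : 0 ≤ (n : ℝ) * K.trace := by positivity
    nlinarith
  rw [sum_Icc_one_eq_sum_range]
  refine le_trans (Finset.sum_le_sum fun i _ => ?_) hfin
  rw [EuclideanSpace.real_norm_sq_eq]
  refine Finset.sum_le_sum fun j _ => ?_
  have := hK.one_le_apply j
  nlinarith [sq_nonneg (x (i + 1) j)]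

/-! ### Noise correlation and excitation on a fixed trajectory. -/

/-- A self-normalized bound extracted from a grid of linearization parameters. -/
theorem sq_le_of_forall_grid {n : ℕ} {τ L S Q R : ℝ} (hn : 0 < n) (hτ : 0 < τ) (hL : 0 < L)
    (hQ : 0 ≤ Q) (hR : 1 ≤ R) (hQR : Q ≤ 8 * n * R) {lam : ℕ → ℝ}
    (hlam : ∀ k, lam k = √(L / (8 * τ ^ 2 * n * k)))
    (hS : ∀ k ∈ Finset.Icc 1 ⌈8 * R⌉₊,
      lam k * S - 8 * τ ^ 2 * (lam k ^ 2 * Q) ≤ L ∧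
      -lam k * S - 8 * τ ^ 2 * (lam k ^ 2 * Q) ≤ L) :
    S ^ 2 ≤ 32 * τ ^ 2 * L * (Q + n) := by
  have hn' : (0 : ℝ) < n := by exact_mod_cast hn
  -- `lam k` equates the compensator at `Q = nk` with `L`. Rounding `Q/n` up, to at least `1`, gives
  -- a near-optimal `k`, at the cost of the extra `n` in the bound.
  obtain ⟨k, hk, hk1, hk2⟩ : ∃ k ∈ Finset.Icc 1 ⌈8 * R⌉₊, Q ≤ n * k ∧ (n : ℝ) * k ≤ Q + n := by
    rcases le_total Q n with h | h
    · refine ⟨1, ?_, by simpa using h, by simpa using hQ⟩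
      rw [Finset.mem_Icc]
      exact ⟨le_rfl, Nat.one_le_ceil_iff.2 (by linarith)⟩
    · refine ⟨⌈Q / n⌉₊, ?_, ?_, ?_⟩
      · rw [Finset.mem_Icc]
        refine ⟨Nat.one_le_ceil_iff.2 (div_pos (hn'.trans_le h) hn'), Nat.ceil_le_ceil ?_⟩
        rw [div_le_iff₀ hn']; linarith
      · have := Nat.le_ceil (Q / n)
        rw [div_le_iff₀ hn'] at this
        linarith
      · have := (Nat.ceil_lt_add_one (div_nonneg hQ hn'.le)).le
        calc (n : ℝ) * ⌈Q / n⌉₊ ≤ n * (Q / n + 1) := by gcongr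
          _ = Q + n := by field_simp
  obtain ⟨h1, h2⟩ := hS k hk
  have hk0 : (0 : ℝ) < k := by
    have := (Finset.mem_Icc.1 hk).1
    exact_mod_cast this
  have hsq : lam k ^ 2 = L / (8 * τ ^ 2 * n * k) := by rw [hlam, Real.sq_sqrt (by positivity)]
  have h3 : 8 * τ ^ 2 * (lam k ^ 2 * Q) ≤ L := by
    rw [hsq]
    calc 8 * τ ^ 2 * (L / (8 * τ ^ 2 * n * k) * Q) = L * (Q / (n * k)) := by field_simp
      _ ≤ L * 1 := by
        gcongr
        exact (div_le_one (by positivity)).2 hk1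
      _ = L := mul_one L
  have h4 : (lam k * S) ^ 2 ≤ (2 * L) ^ 2 := sq_le_sq' (by linarith) (by linarith)
  rw [mul_pow, hsq, div_mul_eq_mul_div, div_le_iff₀ (by positivity)] at h4
  have h5 : S ^ 2 ≤ 32 * τ ^ 2 * L * (n * k) := by
    refine le_of_mul_le_mul_left (a := L) ?_ hL
    calc L * S ^ 2 ≤ _ := h4
      _ = _ := by ring
  refine h5.trans ?_
  gcongr

theorem Matrix.frobenius_norm_sq {m n : Type*} [Fintype m] [Fintype n] (A : Matrix m n ℝ) :
    ‖A‖ ^ 2 = ∑ i, ∑ j, A i j ^ 2 := by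
  rw [Matrix.frobenius_norm_def, ← Real.sqrt_eq_rpow, Real.sq_sqrt (by positivity)]
  simp

/-- Points of the cube `[-1, 1] ^ d` with coordinates in `(1 / N) ℤ`. -/
noncomputable def gridPoint {d : ℕ} (N : ℕ) (p : Fin d → Fin (2 * N + 1)) : Vec d :=
  WithLp.toLp 2 fun j => (((p j : ℕ) : ℝ) - N) / N

theorem exists_gridPoint_near {d N : ℕ} (hN : 0 < N) {u : Vec d} (hu : ‖u‖ = 1) :
    ∃ p, ‖u - gridPoint N p‖ ^ 2 ≤ d / (N : ℝ) ^ 2 := by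
  have hN' : (0 : ℝ) < N := by exact_mod_cast hN
  have hu1 : ∀ j, |u j| ≤ 1 := fun j => hu ▸ PiLp.norm_apply_le u j
  have hp : ∀ j, ∃ p : Fin (2 * N + 1), |u j - (((p : ℕ) : ℝ) - N) / N| ≤ 1 / N := by
    intro j
    have hj := abs_le.1 (hu1 j)
    have h0 : 0 ≤ (u j + 1) * N := mul_nonneg (by linarith) hN'.le
    have hfl := Nat.floor_le h0
    have hfl2 := (Nat.lt_floor_add_one ((u j + 1) * N)).le
    refine ⟨⟨⌊(u j + 1) * N⌋₊, ?_⟩, ?_⟩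
    · have : ((⌊(u j + 1) * N⌋₊ : ℕ) : ℝ) ≤ ((2 * N : ℕ) : ℝ) := by
        push_cast
        nlinarith
      have := Nat.cast_le.1 this
      omega
    · have e : u j - (((⌊(u j + 1) * N⌋₊ : ℕ) : ℝ) - N) / N
          = ((u j + 1) * N - (⌊(u j + 1) * N⌋₊ : ℕ)) / N := by field_simp; ring
      simp only
      rw [e, abs_div, abs_of_pos hN']
      gcongr
      rw [abs_le]
      constructor <;> linarith
  choose p hp using hp
  refine ⟨p, ?_⟩
  rw [EuclideanSpace.real_norm_sq_eq]
  calc _ ≤ ∑ _j : Fin d, (1 / (N : ℝ)) ^ 2 := by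
        refine Finset.sum_le_sum fun j _ => ?_
        rw [← sq_abs]
        have := hp j
        simp only [gridPoint, PiLp.sub_apply]
        gcongr
    _ = d / (N : ℝ) ^ 2 := by simp; field_simp

/-- The three empirical properties of a trajectory used by the analysis of the algorithm: bounded
energy, small noise correlation and a well-conditioned empirical covariance. -/
structure IsRegularTrajectory {d : ℕ} (n : ℕ) (x e : ℕ → Vec d) (R C : ℝ) : Prop where
  energy : ∑ i ∈ Finset.Icc 1 n, ‖x i‖ ^ 2 ≤ 8 * n * R
  noise : ‖∑ i ∈ Finset.Icc 1 n, Matrix.vecMulVec (e i).ofLp (x i).ofLp‖ ^ 2 ≤ C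
  excitation : ∀ u : Vec d, n / 32 * ‖u‖ ^ 2 ≤ ∑ i ∈ Finset.Icc 1 n, inner ℝ (x i) u ^ 2

/-- Write `⟨x (i+1), v⟩ = F + E`, drift plus fresh noise. The coefficient `1/(16τ²)` makes the
compensator `F²/(32τ²)`, so `∑ (F² + 2FE) ≥ -32τ²L`. The lower tail gives `∑ E² ≥ 3n/4 - 64τ⁴L`, and
`hLn` keeps the total loss below `n/4`. -/
theorem excitation_of_unit {d n : ℕ} {f : Vec d → Vec d} {e : ℕ → Vec d} {v : Vec d}
    (hv : ‖v‖ = 1) {τ L : ℝ} (hτ : 0 < τ) (hτ1 : 1 ≤ 2 * τ ^ 2) (hL : 0 ≤ L)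
    (hLn : 512 * τ ^ 4 * L ≤ n)
    (hcross : ∑ i ∈ Finset.range n,
      (inner ℝ (e i) ((-(1 / (16 * τ ^ 2) * inner ℝ (f (trajectory f e i)) v)) • v) -
        8 * τ ^ 2 * ‖(-(1 / (16 * τ ^ 2) * inner ℝ (f (trajectory f e i)) v)) • v‖ ^ 2) ≤ L)
    (hnoise : ∑ i ∈ Finset.range n,
      (-(1 / (64 * τ ^ 4) * inner ℝ (e i) v ^ 2) + 3 / 4 * (1 / (64 * τ ^ 4))) ≤ L) :
    (n : ℝ) / 2 ≤ ∑ i ∈ Finset.Icc 1 n, inner ℝ (trajectory f e i) v ^ 2 := by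
  set x := trajectory f e with hx
  set F : ℕ → ℝ := fun i => inner ℝ (f (x i)) v with hF
  set E : ℕ → ℝ := fun i => inner ℝ (e i) v with hE
  have hstep : ∀ i, inner ℝ (x (i + 1)) v ^ 2 = F i ^ 2 + 2 * (F i * E i) + E i ^ 2 := by
    intro i
    have : x (i + 1) = f (x i) + e i := rfl
    rw [this, inner_add_left]
    ring
  rw [sum_Icc_one_eq_sum_range]
  simp_rw [hstep]
  rw [Finset.sum_add_distrib, Finset.sum_add_distrib, ← Finset.mul_sum]
  have h1 : -(1 / (16 * τ ^ 2)) * ∑ i ∈ Finset.range n, F i * E i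
      - 1 / (32 * τ ^ 2) * ∑ i ∈ Finset.range n, F i ^ 2 ≤ L := by
    refine le_trans (le_of_eq ?_) hcross
    rw [Finset.mul_sum, Finset.mul_sum, ← Finset.sum_sub_distrib]
    refine Finset.sum_congr rfl fun i _ => ?_
    rw [inner_smul_right, norm_smul, hv, mul_one, Real.norm_eq_abs, sq_abs]
    simp only [hF, hE]
    field_simp
    ring
  have h2 : -(1 / (64 * τ ^ 4)) * ∑ i ∈ Finset.range n, E i ^ 2
      + 3 / 4 * (1 / (64 * τ ^ 4)) * n ≤ L := by
    refine le_trans (le_of_eq ?_) hnoise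
    rw [Finset.mul_sum, Finset.sum_add_distrib]
    congr 1
    · exact Finset.sum_congr rfl fun i _ => by simp only [hE]; ring
    · simp; ring
  have h3 : -(∑ i ∈ Finset.range n, F i ^ 2 + 2 * ∑ i ∈ Finset.range n, F i * E i)
      ≤ 32 * τ ^ 2 * L := by
    have := mul_le_mul_of_nonneg_left h1 (by positivity : 0 ≤ 32 * τ ^ 2)
    refine le_trans (le_of_eq ?_) this
    field_simp
    ring
  have h4 : -(∑ i ∈ Finset.range n, E i ^ 2) + 3 / 4 * n ≤ 64 * τ ^ 4 * L := by
    have := mul_le_mul_of_nonneg_left h2 (by positivity : 0 ≤ 64 * τ ^ 4)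
    refine le_trans (le_of_eq ?_) this
    field_simp
  have h5 : 32 * τ ^ 2 * L ≤ 64 * τ ^ 4 * L := by
    have : 32 * τ ^ 2 ≤ 64 * τ ^ 4 := by nlinarith
    gcongr
  linarith

/-- Passing from a net to all directions. -/
theorem excitation_of_grid {d n N : ℕ} (hN : 0 < N) {R : ℝ} (hR : 1 ≤ R) (hdR : (d : ℝ) ≤ R)
    (hNR : 20 * R ≤ N) {x : ℕ → Vec d} (henergy : ∑ i ∈ Finset.Icc 1 n, ‖x i‖ ^ 2 ≤ 8 * n * R)
    (hgrid : ∀ p : Fin d → Fin (2 * N + 1), gridPoint N p ≠ 0 →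
      (n : ℝ) / 2 ≤ ∑ i ∈ Finset.Icc 1 n, inner ℝ (x i) (‖gridPoint N p‖⁻¹ • gridPoint N p) ^ 2)
    (u : Vec d) :
    n / 32 * ‖u‖ ^ 2 ≤ ∑ i ∈ Finset.Icc 1 n, inner ℝ (x i) u ^ 2 := by
  have hn0 : (0 : ℝ) ≤ n := Nat.cast_nonneg n
  have hq : ∀ z : Vec d, ∑ i ∈ Finset.Icc 1 n, inner ℝ (x i) z ^ 2 ≤ 8 * n * R * ‖z‖ ^ 2 := by
    intro z
    refine le_trans ?_ (mul_le_mul_of_nonneg_right henergy (sq_nonneg ‖z‖))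
    rw [Finset.sum_mul]
    refine Finset.sum_le_sum fun i _ => ?_
    rw [← mul_pow, ← sq_abs]
    gcongr
    exact abs_real_inner_le_norm _ _
  have hg : ∀ p : Fin d → Fin (2 * N + 1), n / 2 * ‖gridPoint N p‖ ^ 2 ≤
      ∑ i ∈ Finset.Icc 1 n, inner ℝ (x i) (gridPoint N p) ^ 2 := by
    intro p
    rcases eq_or_ne (gridPoint N p) 0 with h | h
    · rw [h]; simp
    · have h1 := hgrid p h
      have h2 : 0 < ‖gridPoint N p‖ := norm_pos_iff.2 h
      simp_rw [inner_smul_right, mul_pow] at h1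
      rw [← Finset.mul_sum, inv_pow, inv_mul_eq_div, le_div_iff₀ (by positivity)] at h1
      exact h1
  have hunit : ∀ u : Vec d, ‖u‖ = 1 → (n : ℝ) / 32 ≤ ∑ i ∈ Finset.Icc 1 n, inner ℝ (x i) u ^ 2 := by
    intro u hu
    obtain ⟨p, hp⟩ := exists_gridPoint_near hN hu
    set g := gridPoint N p with hgdef
    have hN' : (0 : ℝ) < N := by exact_mod_cast hN
    -- The mesh is of order `1/R` because the empirical covariance may be as large as `8nR`: moving
    -- to the net then changes the quadratic form by only `n/50`.
    have hdN : (d : ℝ) / (N : ℝ) ^ 2 ≤ 1 / (400 * R) := by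
      rw [div_le_div_iff₀ (by positivity) (by positivity)]
      nlinarith
    have hclose : ‖u - g‖ ^ 2 ≤ 1 / (400 * R) := hp.trans hdN
    have hsmall : ‖u - g‖ ≤ 1 / 20 := by
      have : 1 / (400 * R) ≤ (1 / 20 : ℝ) ^ 2 := by
        rw [div_le_iff₀ (by positivity)]; nlinarith
      exact le_of_sq_le_sq (hclose.trans this) (by norm_num)
    have hgn : 19 / 20 ≤ ‖g‖ := by
      have := norm_sub_norm_le u g
      linarith
    have h1 : n / 2 * (19 / 20 : ℝ) ^ 2 ≤ ∑ i ∈ Finset.Icc 1 n, inner ℝ (x i) g ^ 2 := by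
      refine le_trans ?_ (hg p)
      gcongr
    have h2 : ∑ i ∈ Finset.Icc 1 n, inner ℝ (x i) (u - g) ^ 2 ≤ n / 50 := by
      refine (hq _).trans ?_
      calc 8 * n * R * ‖u - g‖ ^ 2 ≤ 8 * n * R * (1 / (400 * R)) := by gcongr
        _ = n / 50 := by field_simp; ring
    have h3 : ∑ i ∈ Finset.Icc 1 n, inner ℝ (x i) g ^ 2 ≤
        2 * ∑ i ∈ Finset.Icc 1 n, inner ℝ (x i) u ^ 2 +
        2 * ∑ i ∈ Finset.Icc 1 n, inner ℝ (x i) (u - g) ^ 2 := by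
      rw [Finset.mul_sum, Finset.mul_sum, ← Finset.sum_add_distrib]
      refine Finset.sum_le_sum fun i _ => ?_
      rw [inner_sub_right]
      nlinarith [sq_nonneg (2 * inner ℝ (x i) u - inner ℝ (x i) g)]
    linarith
  rcases eq_or_ne u 0 with rfl | hu
  · simp
  · have hu' : 0 < ‖u‖ := norm_pos_iff.2 hu
    have h1 := hunit (‖u‖⁻¹ • u) (by rw [norm_smul, norm_inv, norm_norm, inv_mul_cancel₀ hu'.ne'])
    simp_rw [inner_smul_right, mul_pow] at h1
    rw [← Finset.mul_sum, inv_pow, inv_mul_eq_div, le_div_iff₀ (by positivity)] at h1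
    exact h1

/-- Frobenius bound of the noise correlation from entrywise self-normalized bounds. -/
theorem noise_of_grid {d n : ℕ} (hn : 0 < n) {x e : ℕ → Vec d} {τ L R : ℝ} (hx0 : x 0 = 0)
    (hτ : 0 < τ) (hL : 0 < L) (hR : 1 ≤ R) (hdR : (d : ℝ) ≤ R)
    (henergy : ∑ i ∈ Finset.Icc 1 n, ‖x i‖ ^ 2 ≤ 8 * n * R) {lam : ℕ → ℝ}
    (hlam : ∀ k, lam k = √(L / (8 * τ ^ 2 * n * k)))
    (hgrid : ∀ (a b : Fin d) (s : ℝ), s = 1 ∨ s = -1 → ∀ k ∈ Finset.Icc 1 ⌈8 * R⌉₊,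
      ∑ i ∈ Finset.range (n + 1),
        (inner ℝ (e i) (EuclideanSpace.single a (s * lam k * x i b)) -
        8 * τ ^ 2 * ‖(EuclideanSpace.single a (s * lam k * x i b) : Vec d)‖ ^ 2) ≤ L) :
    ‖∑ i ∈ Finset.Icc 1 n, Matrix.vecMulVec (e i).ofLp (x i).ofLp‖ ^ 2
      ≤ 288 * τ ^ 2 * d * R * L * n := by
  set Q : Fin d → ℝ := fun b => ∑ i ∈ Finset.Icc 1 n, x i b ^ 2 with hQ
  have hQ0 : ∀ b, 0 ≤ Q b := fun b => Finset.sum_nonneg fun i _ => sq_nonneg _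
  have hQsum : ∑ b, Q b ≤ 8 * n * R := by
    refine le_trans (le_of_eq ?_) henergy
    simp only [hQ]
    rw [Finset.sum_comm]
    exact Finset.sum_congr rfl fun i _ => (EuclideanSpace.real_norm_sq_eq _).symm
  have hQle : ∀ b, Q b ≤ 8 * n * R := fun b =>
    (Finset.single_le_sum (fun b _ => hQ0 b) (Finset.mem_univ b)).trans hQsum
  have hentry : ∀ a b, (∑ i ∈ Finset.Icc 1 n, e i a * x i b) ^ 2
      ≤ 32 * τ ^ 2 * L * (Q b + n) := by
    intro a b
    have key : ∀ s : ℝ, s = 1 ∨ s = -1 → ∀ k ∈ Finset.Icc 1 ⌈8 * R⌉₊,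
        s * lam k * (∑ i ∈ Finset.Icc 1 n, e i a * x i b)
          - 8 * τ ^ 2 * (lam k ^ 2 * Q b) ≤ L := by
      intro s hs k hk
      refine le_trans (le_of_eq ?_) (hgrid a b s hs k hk)
      -- The tail events sum from time `0`; that term vanishes since `x 0 = 0`.
      rw [Finset.sum_range_succ', ← sum_Icc_one_eq_sum_range (fun i =>
        inner ℝ (e i) (EuclideanSpace.single a (s * lam k * x i b)) -
        8 * τ ^ 2 * ‖(EuclideanSpace.single a (s * lam k * x i b) : Vec d)‖ ^ 2), hx0]
      have hs2 : s ^ 2 = 1 := by rcases hs with rfl | rfl <;> norm_num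
      simp only [hQ, Finset.mul_sum, PiLp.norm_single, EuclideanSpace.inner_single_right,
        PiLp.zero_apply, mul_zero, norm_zero, Real.norm_eq_abs, sq_abs, mul_pow, hs2, one_mul]
      rw [← Finset.sum_sub_distrib]
      simp
      refine Finset.sum_congr rfl fun i _ => ?_
      ring
    refine sq_le_of_forall_grid hn hτ hL (hQ0 b) hR (hQle b) hlam fun k hk => ⟨?_, ?_⟩
    · simpa using key 1 (Or.inl rfl) k hk
    · simpa using key (-1) (Or.inr rfl) k hk
  rw [Matrix.frobenius_norm_sq]
  have e1 : ∀ a b, (∑ i ∈ Finset.Icc 1 n, Matrix.vecMulVec (e i).ofLp (x i).ofLp) a b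
      = ∑ i ∈ Finset.Icc 1 n, e i a * x i b := by
    intro a b
    rw [Matrix.sum_apply]
    rfl
  simp_rw [e1]
  calc _ ≤ ∑ _a : Fin d, ∑ b : Fin d, 32 * τ ^ 2 * L * (Q b + n) :=
        Finset.sum_le_sum fun a _ => Finset.sum_le_sum fun b _ => hentry a b
    _ = d * (32 * τ ^ 2 * L * (∑ b, Q b + d * n)) := by
        rw [Finset.sum_const, ← Finset.mul_sum, Finset.sum_add_distrib]; simp
    _ ≤ d * (32 * τ ^ 2 * L * (8 * n * R + R * n)) := by gcongr
    _ = _ := by ring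

/-! ### The union bound: regularity with high probability. -/

/-- With `s = R/δ + 1`, each tail is `s⁻¹²`, while `2`, `d`, `R` and `1/δ` are all at most `s`. The
net has at most `s^(7d)` points, so its events use level `d * L`, with tail `s^(-12d)`. -/
theorem failure_probability_le {d N : ℕ} {R δ : ℝ} (hd : 0 < d) (hdR : (d : ℝ) ≤ R) (hδ : 0 < δ)
    (hδ1 : δ < 1) (hN : (N : ℝ) ≤ 20 * R + 1) {L : ℝ} (hL : L = 12 * Real.log (R / δ + 1)) :
    2 * Real.exp (-L) + d * (d * (⌈8 * R⌉₊ * (2 * Real.exp (-L)))) +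
      2 * (((2 * N + 1 : ℕ) : ℝ) ^ d * Real.exp (-(d * L))) ≤ δ := by
  have hd1 : (1 : ℝ) ≤ d := by exact_mod_cast hd
  have hR1 : 1 ≤ R := hd1.trans hdR
  set s := R / δ + 1 with hs
  have hRδ : R ≤ R / δ := by rw [le_div_iff₀ hδ]; nlinarith
  have hs2 : 2 ≤ s := by linarith
  have hsR : R ≤ s := by linarith
  have hsδ : 1 ≤ s * δ := by rw [hs, add_mul, div_mul_cancel₀ _ hδ.ne']; nlinarith
  have hs0 : 0 < s := by linarith
  have hexp : Real.exp (-L) = (s ^ 12)⁻¹ := by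
    rw [Real.exp_neg, hL, show (12 : ℝ) * Real.log s = (12 : ℕ) * Real.log s by norm_num,
      Real.exp_nat_mul, Real.exp_log hs0]
  have hinv : s⁻¹ ≤ δ := by rw [inv_le_iff_one_le_mul₀ hs0]; linarith
  have hpow : ∀ k : ℕ, (2 : ℝ) ^ k * (s ^ (k + 1))⁻¹ ≤ δ := by
    intro k
    refine le_trans ?_ hinv
    rw [pow_succ, mul_inv, ← mul_assoc]
    have : (2 : ℝ) ^ k * (s ^ k)⁻¹ ≤ 1 := by
      rw [← div_eq_mul_inv]
      exact (div_le_one (by positivity)).2 (by gcongr)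
    exact mul_le_of_le_one_left (by positivity) this
  have t1 : 2 * Real.exp (-L) ≤ δ / 4 := by
    rw [hexp]
    have := hpow 11
    norm_num at this ⊢
    have h0 : 0 < (s ^ 12)⁻¹ := by positivity
    linarith
  have t2 : d * (d * (⌈8 * R⌉₊ * (2 * Real.exp (-L)))) ≤ δ / 4 := by
    have hceil : (⌈8 * R⌉₊ : ℝ) ≤ 9 * s := by
      have := (Nat.ceil_lt_add_one (by linarith : 0 ≤ 8 * R)).le
      linarith
    have hds : (d : ℝ) ≤ s := hdR.trans hsR
    calc (d : ℝ) * (d * (⌈8 * R⌉₊ * (2 * Real.exp (-L))))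
        ≤ s * (s * (9 * s * (2 * Real.exp (-L)))) := by gcongr
      _ = 18 * (s ^ 9)⁻¹ := by rw [hexp]; field_simp; ring
      _ ≤ δ / 4 := by
        have := hpow 8
        norm_num at this
        linarith
  have t3 : 2 * (((2 * N + 1 : ℕ) : ℝ) ^ d * Real.exp (-(d * L))) ≤ δ / 4 := by
    have hbase : ((2 * N + 1 : ℕ) : ℝ) ≤ s ^ 7 := by
      push_cast
      have h6 : (2 : ℝ) ^ 6 ≤ s ^ 6 := by gcongr
      have : s ^ 7 = s ^ 6 * s := by ring
      nlinarith
    have e1 : Real.exp (-(d * L)) = ((s ^ 12)⁻¹) ^ d := by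
      rw [← hexp, ← Real.exp_nat_mul]; ring_nf
    have h1 : ((2 * N + 1 : ℕ) : ℝ) * (s ^ 12)⁻¹ ≤ (s ^ 5)⁻¹ := by
      calc _ ≤ s ^ 7 * (s ^ 12)⁻¹ := by gcongr
        _ = (s ^ 5)⁻¹ := by field_simp
    have h2 : (s ^ 5)⁻¹ ≤ 1 := inv_le_one_of_one_le₀ (one_le_pow₀ (by linarith))
    rw [e1, ← mul_pow]
    have h3 : (((2 * N + 1 : ℕ) : ℝ) * (s ^ 12)⁻¹) ^ d ≤ (s ^ 5)⁻¹ := by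
      calc _ ≤ ((s ^ 5)⁻¹) ^ d := by gcongr
        _ ≤ (s ^ 5)⁻¹ := pow_le_of_le_one (by positivity) h2 hd.ne'
    have := hpow 4
    norm_num at this
    linarith
  linarith

namespace IsNoise

variable {Ω : Type*} [MeasurableSpace Ω] {P : Measure Ω} [IsProbabilityMeasure P] {d n : ℕ}
  {ε : ℕ → Ω → Vec d} {τ : ℝ}

theorem measure_sum_inner_ge_le (hε : IsNoise P n ε τ) (hτ : 0 ≤ τ) {f : Vec d → Vec d}
    (hf : Measurable f) {w : Vec d → Vec d} (hw : Measurable w) {N : ℕ} (hN : N ≤ n + 1) (L : ℝ) :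
    P {ω | L ≤ ∑ i ∈ Finset.range N,
        (inner ℝ (ε i ω) (w (trajectory f (fun j => ε j ω) i)) -
          8 * τ ^ 2 * ‖w (trajectory f (fun j => ε j ω) i)‖ ^ 2)}
      ≤ ENNReal.ofReal (Real.exp (-L)) :=
  hε.measure_sum_trajectory_ge_le hf
    (Z := fun y e => inner ℝ e (w y) - 8 * τ ^ 2 * ‖w y‖ ^ 2)
    (by
      have h1 : Measurable fun z : Vec d × Vec d => w z.1 := hw.comp measurable_fst
      exact (measurable_snd.inner h1).sub ((h1.norm.pow_const 2).const_mul _))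
    (fun _ hi y => hε.lintegral_exp_inner_le_one hτ hi (w y)) hN L

theorem measure_sum_weighted_sq_ge_le (hε : IsNoise P n ε τ) (hτ : 0 ≤ τ) (hτ1 : 1 ≤ 2 * τ ^ 2)
    {w : Fin d → ℝ} (hw : ∀ j, 0 ≤ w j)
    (hw1 : ∑ j, w j = 1) {u : ℝ} (hu : 0 ≤ u) (huτ : 9216 * τ ^ 4 * u ≤ 1) {N : ℕ}
    (hN : N ≤ n + 1) (L : ℝ) :
    P {ω | L ≤ ∑ i ∈ Finset.range N, (u * ∑ j, w j * ε i ω j ^ 2 - 2 * u)}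
      ≤ ENNReal.ofReal (Real.exp (-L)) :=
  hε.measure_sum_trajectory_ge_le measurable_id
    (Z := fun _ e => u * ∑ j, w j * e j ^ 2 - 2 * u)
    (by unfold Function.uncurry; fun_prop)
    (fun _ hi _ => hε.lintegral_exp_weighted_sq_le_one hτ hτ1 hi hw hw1 hu huτ) hN L

theorem measure_sum_neg_inner_sq_ge_le (hε : IsNoise P n ε τ) (hτ : 0 ≤ τ) {v : Vec d}
    (hv : ‖v‖ = 1) {u : ℝ} (hu : 0 ≤ u) (huτ : 64 * τ ^ 4 * u ≤ 1) {N : ℕ}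
    (hN : N ≤ n + 1) (L : ℝ) :
    P {ω | L ≤ ∑ i ∈ Finset.range N, (-(u * inner ℝ (ε i ω) v ^ 2) + 3 / 4 * u)}
      ≤ ENNReal.ofReal (Real.exp (-L)) :=
  hε.measure_sum_trajectory_ge_le measurable_id
    (Z := fun _ e => -(u * inner ℝ e v ^ 2) + 3 / 4 * u)
    (by unfold Function.uncurry; fun_prop)
    (fun _ hi _ => hε.lintegral_exp_neg_inner_sq_le_one hτ hi hv hu huτ) hN L

/-- With high probability the trajectory is regular. -/
theorem measure_not_isRegularTrajectory_le (hε : IsNoise P n ε τ) {σ : Fin d → ℝ → ℝ}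
    {Θ K : Mat d} {ρ δ : ℝ} (hσ : IsLink σ) (hK : IsDiagLyapunov Θ K ρ) (hd : 0 < d)
    (hδ : 0 < δ) (hδ1 : δ < 1) {l : ℝ} (hl : l = Real.log (effRadius K ρ / δ + 1))
    (hn : 110592 * (τ ^ 4 * d * l) ≤ n * (1 - ρ)) :
    P {ω | ¬ IsRegularTrajectory n (trajectory (glm σ Θ) fun j => ε j ω) (fun j => ε j ω)
        (effRadius K ρ) (3456 * τ ^ 2 * d * effRadius K ρ * l * n)}
      ≤ ENNReal.ofReal δ := by
  obtain ⟨hτ, hτ1⟩ := hε.pos_and_one_le_two_mul_sq hd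
  have hρ := hK.rho_lt_one
  have hρ0 := hK.rho_nonneg
  set R := effRadius K ρ with hR
  have hdT := hK.card_le_trace
  have hd1 : (1 : ℝ) ≤ d := by exact_mod_cast hd
  have hT : 0 < K.trace := by linarith
  have hTR : K.trace ≤ R := hK.trace_le_effRadius
  have hdR : (d : ℝ) ≤ R := hdT.trans hTR
  have hR1 : 1 ≤ R := hd1.trans hdR
  have hl0 : 0 < l := by
    rw [hl]
    refine Real.log_pos ?_
    have : 0 < R / δ := by positivity
    linarith
  set L := 12 * l with hL
  have hL0 : 0 < L := by positivity
  have hτ4 : τ ^ 2 ≤ 2 * τ ^ 4 := by nlinarith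
  have hτl : τ ^ 4 * l ≤ τ ^ 4 * d * l := by
    have : 0 ≤ τ ^ 4 * l := by positivity
    nlinarith
  have hτl2 : τ ^ 2 * l ≤ 2 * (τ ^ 4 * l) := by nlinarith
  have hnn : (n : ℝ) * (1 - ρ) ≤ n := by nlinarith [(Nat.cast_nonneg n : (0 : ℝ) ≤ n)]
  have hn0 : 0 < n := by
    have : (0 : ℝ) < n := by
      have : 0 < 110592 * (τ ^ 4 * d * l) := by positivity
      linarith
    exact_mod_cast this
  set f := glm σ Θ with hf
  have hfm : Measurable f := measurable_glm hσ Θ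
  set N := ⌈20 * R⌉₊ with hN
  have hN1 : 20 * R ≤ N := Nat.le_ceil _
  have hN2 : (N : ℝ) ≤ 20 * R + 1 := (Nat.ceil_lt_add_one (by linarith)).le
  have hN0 : 0 < N := by
    have : (0 : ℝ) < N := by linarith
    exact_mod_cast this
  set lam : ℕ → ℝ := fun k => √(L / (8 * τ ^ 2 * n * k)) with hlam
  set lamK : ℝ := (1 - ρ) / (64 * τ ^ 2 * K.trace) with hlamK
  set uK : ℝ := 1 / (9216 * τ ^ 4) with huK
  set uv : ℝ := 1 / (64 * τ ^ 4) with huv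
  set v : (Fin d → Fin (2 * N + 1)) → Vec d := fun p => ‖gridPoint N p‖⁻¹ • gridPoint N p with hv
  let x : Ω → ℕ → Vec d := fun ω => trajectory f fun j => ε j ω
  let lin : ℕ → (Vec d → Vec d) → ℝ → Set Ω := fun N w L =>
    {ω | L ≤ ∑ i ∈ Finset.range N,
      (inner ℝ (ε i ω) (w (x ω i)) - 8 * τ ^ 2 * ‖w (x ω i)‖ ^ 2)}
  let wK : Vec d → Vec d := fun y => lamK • weightVec K (f y)
  let wE : Fin d → Fin d → ℝ → ℕ → Vec d → Vec d := fun a b s k y =>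
    EuclideanSpace.single a (s * lam k * y b)
  let wV : (Fin d → Fin (2 * N + 1)) → Vec d → Vec d := fun p y =>
    (-(1 / (16 * τ ^ 2) * inner ℝ (f y) (v p))) • v p
  let badK : Set Ω := lin n wK L
  let badY : Set Ω :=
    {ω | L ≤ ∑ i ∈ Finset.range n, (uK * ∑ j, K j j / K.trace * ε i ω j ^ 2 - 2 * uK)}
  let badE : Set Ω := ⋃ a : Fin d, ⋃ b : Fin d, ⋃ k ∈ Finset.Icc 1 ⌈8 * R⌉₊,
    (lin (n + 1) (wE a b 1 k) L ∪ lin (n + 1) (wE a b (-1) k) L)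
  -- The zero grid point has no direction: there `v p = 0`, and without the guard the lower-tail
  -- event would be certain.
  let badV : Set Ω := ⋃ p : Fin d → Fin (2 * N + 1),
    (lin n (wV p) (d * L) ∪ {ω | gridPoint N p ≠ 0 ∧ d * L ≤
      ∑ i ∈ Finset.range n, (-(uv * inner ℝ (ε i ω) (v p) ^ 2) + 3 / 4 * uv)})
  have hwK : Measurable wK := ((measurable_weightVec K).comp hfm).const_smul lamK
  have hwE : ∀ a b s k, Measurable (wE a b s k) := by
    intro a b s k
    have : Continuous (wE a b s k) := by
      refine (PiLp.continuous_toLp 2 _).comp (continuous_pi fun j => ?_)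
      by_cases h : j = a
      · subst h; simp; fun_prop
      · simp [h]; fun_prop
    exact this.measurable
  have hwV : ∀ p, Measurable (wV p) := by
    intro p
    have : Measurable fun y => inner ℝ (f y) (v p) := hfm.inner measurable_const
    exact (this.const_mul _).neg.smul_const _
  have hlin : ∀ M ≤ n + 1, ∀ w, Measurable w → ∀ L, P (lin M w L) ≤ ENNReal.ofReal (Real.exp (-L)) :=
    fun M hM w hw L => hε.measure_sum_inner_ge_le hτ.le hfm hw hM L
  have huK0 : 0 < uK := by positivity
  have hPK : P badK ≤ ENNReal.ofReal (Real.exp (-L)) := hlin n (by omega) wK hwK L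
  have hPY : P badY ≤ ENNReal.ofReal (Real.exp (-L)) := by
    refine hε.measure_sum_weighted_sq_ge_le hτ.le hτ1 (w := fun j => K j j / K.trace)
      (fun j => ?_) ?_ huK0.le ?_ (by omega) L
    · have := hK.one_le_apply j
      positivity
    · rw [← Finset.sum_div]
      exact div_self hT.ne'
    · rw [huK]
      field_simp
      exact le_rfl
  have hPE : P badE ≤ ENNReal.ofReal (d * (d * (⌈8 * R⌉₊ * (2 * Real.exp (-L))))) := by
    have h1 : ∀ a b k, P (lin (n + 1) (wE a b 1 k) L ∪ lin (n + 1) (wE a b (-1) k) L)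
        ≤ ENNReal.ofReal (2 * Real.exp (-L)) := by
      intro a b k
      refine (measure_union_le _ _).trans ?_
      rw [two_mul, ENNReal.ofReal_add (Real.exp_pos _).le (Real.exp_pos _).le]
      exact add_le_add (hlin _ le_rfl _ (hwE _ _ _ _) _) (hlin _ le_rfl _ (hwE _ _ _ _) _)
    have h2 : ∀ a b, P (⋃ k ∈ Finset.Icc 1 ⌈8 * R⌉₊,
        (lin (n + 1) (wE a b 1 k) L ∪ lin (n + 1) (wE a b (-1) k) L))
        ≤ ENNReal.ofReal (⌈8 * R⌉₊ * (2 * Real.exp (-L))) := by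
      intro a b
      refine (measure_biUnion_finset_le _ _).trans ((Finset.sum_le_sum fun k _ => h1 a b k).trans ?_)
      rw [Finset.sum_const, Nat.card_Icc, Nat.add_sub_cancel, nsmul_eq_mul,
        ENNReal.ofReal_mul (Nat.cast_nonneg _), ENNReal.ofReal_natCast]
    have h3 : ∀ a, P (⋃ b, ⋃ k ∈ Finset.Icc 1 ⌈8 * R⌉₊,
        (lin (n + 1) (wE a b 1 k) L ∪ lin (n + 1) (wE a b (-1) k) L))
        ≤ ENNReal.ofReal (d * (⌈8 * R⌉₊ * (2 * Real.exp (-L)))) := by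
      intro a
      refine (measure_iUnion_fintype_le _ _).trans ((Finset.sum_le_sum fun b _ => h2 a b).trans ?_)
      rw [Finset.sum_const, Finset.card_univ, Fintype.card_fin, nsmul_eq_mul,
        ENNReal.ofReal_mul (Nat.cast_nonneg d), ENNReal.ofReal_natCast]
    refine (measure_iUnion_fintype_le _ _).trans ((Finset.sum_le_sum fun a _ => h3 a).trans ?_)
    rw [Finset.sum_const, Finset.card_univ, Fintype.card_fin, nsmul_eq_mul,
      ← ENNReal.ofReal_natCast, ← ENNReal.ofReal_mul (Nat.cast_nonneg d)]
  have hvunit : ∀ p, gridPoint N p ≠ 0 → ‖v p‖ = 1 := by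
    intro p hp
    simp only [hv]
    rw [norm_smul, norm_inv, norm_norm, inv_mul_cancel₀ (norm_ne_zero_iff.2 hp)]
  have hPV : P badV ≤ ENNReal.ofReal (2 * (((2 * N + 1 : ℕ) : ℝ) ^ d * Real.exp (-(d * L)))) := by
    have h1 : ∀ p, P (lin n (wV p) (d * L) ∪ {ω | gridPoint N p ≠ 0 ∧ d * L ≤
        ∑ i ∈ Finset.range n, (-(uv * inner ℝ (ε i ω) (v p) ^ 2) + 3 / 4 * uv)})
        ≤ ENNReal.ofReal (2 * Real.exp (-(d * L))) := by
      intro p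
      refine (measure_union_le _ _).trans ?_
      rw [two_mul, ENNReal.ofReal_add (Real.exp_pos _).le (Real.exp_pos _).le]
      refine add_le_add (hlin n (by omega) _ (hwV p) _) ?_
      by_cases hp : gridPoint N p = 0
      · simp [hp]
      · refine (measure_mono fun ω hω => hω.2).trans
          (hε.measure_sum_neg_inner_sq_ge_le hτ.le (hvunit p hp) (u := uv) (by positivity) ?_
            (by omega) (d * L))
        rw [huv]
        field_simp
        exact le_rfl
    refine (measure_iUnion_fintype_le _ _).trans ((Finset.sum_le_sum fun p _ => h1 p).trans ?_)
    rw [Finset.sum_const, Finset.card_univ, Fintype.card_fun, Fintype.card_fin, Fintype.card_fin,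
      nsmul_eq_mul, ← ENNReal.ofReal_natCast, ← ENNReal.ofReal_mul (Nat.cast_nonneg _)]
    refine ENNReal.ofReal_le_ofReal (le_of_eq ?_)
    push_cast
    ring
  have hsub : {ω | ¬ IsRegularTrajectory n (x ω) (fun j => ε j ω) R
      (3456 * τ ^ 2 * d * R * l * n)} ⊆ (badK ∪ badY) ∪ badE ∪ badV := by
    intro ω hω
    by_contra hcon
    simp only [Set.mem_union, not_or] at hcon
    obtain ⟨⟨⟨hbK, hbY⟩, hbE⟩, hbV⟩ := hcon
    refine hω ?_
    have henergy := sum_norm_sq_trajectory_le (n := n) (L := L) hσ hK hd hτ (fun j => ε j ω)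
      (lam := lamK) (u := uK) rfl huK0 (by
        rw [huK, mul_one_div, le_div_iff₀ (by positivity)]
        linarith) (by
        have : 128 * τ ^ 2 * L = 1536 * (τ ^ 2 * l) := by rw [hL]; ring
        have : 0 ≤ τ ^ 4 * l := by positivity
        linarith)
      (not_le.1 hbK).le (not_le.1 hbY).le
    refine ⟨henergy, ?_, ?_⟩
    · have h1 := noise_of_grid (x := x ω) (e := fun j => ε j ω) (R := R) (lam := lam) hn0 rfl hτ
        hL0 hR1 hdR henergy (fun k => rfl) (by
          intro a b s hs k hk
          simp only [badE, Set.mem_iUnion, Set.mem_union, not_exists, not_or] at hbE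
          obtain ⟨h1, h2⟩ := hbE a b k hk
          rcases hs with rfl | rfl
          · exact (not_le.1 h1).le
          · exact (not_le.1 h2).le)
      refine h1.trans (le_of_eq ?_)
      rw [hL]; ring
    · refine excitation_of_grid hN0 hR1 hdR hN1 henergy fun p hp => ?_
      simp only [badV, Set.mem_iUnion, Set.mem_union, not_exists, not_or] at hbV
      obtain ⟨h1, h2⟩ := hbV p
      refine excitation_of_unit (f := f) (e := fun j => ε j ω) (hvunit p hp) hτ hτ1
        (L := d * L) (by positivity) ?_ (not_le.1 h1).le ?_
      · have : 512 * τ ^ 4 * (d * L) = 6144 * (τ ^ 4 * d * l) := by rw [hL]; ring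
        have h0 : 0 ≤ τ ^ 4 * d * l := by positivity
        linarith
      · by_contra hc
        exact h2 ⟨hp, (not_le.1 hc).le⟩
  refine (measure_mono hsub).trans ?_
  refine (measure_union_le _ _).trans ?_
  refine (add_le_add ((measure_union_le _ _).trans
    (add_le_add ((measure_union_le _ _).trans (add_le_add hPK hPY)) hPE)) hPV).trans ?_
  rw [← ENNReal.ofReal_add (by positivity) (by positivity),
    ← ENNReal.ofReal_add (by positivity) (by positivity),
    ← ENNReal.ofReal_add (by positivity) (by positivity), ← two_mul]
  exact ENNReal.ofReal_le_ofReal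
    (failure_probability_le hd hdR hδ hδ1 hN2 (by rw [hL, hl]))

end IsNoise

/-! ### Frobenius geometry and projection onto the ball. -/

/-- Matrices as vectors, so that the Frobenius norm becomes Euclidean. -/
def matVec {d : ℕ} (A : Mat d) : EuclideanSpace ℝ (Fin d × Fin d) :=
  WithLp.toLp 2 fun p => A p.1 p.2

section matVec

variable {d : ℕ}

theorem norm_matVec (A : Mat d) : ‖matVec A‖ = ‖A‖ := by
  rw [← sq_eq_sq₀ (norm_nonneg _) (norm_nonneg _), EuclideanSpace.real_norm_sq_eq,
    Matrix.frobenius_norm_sq, Fintype.sum_prod_type]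
  rfl

theorem matVec_sub (A B : Mat d) : matVec (A - B) = matVec A - matVec B := rfl

theorem matVec_smul (c : ℝ) (A : Mat d) : matVec (c • A) = c • matVec A := rfl

theorem matVec_sum {ι : Type*} (s : Finset ι) (A : ι → Mat d) :
    matVec (∑ i ∈ s, A i) = ∑ i ∈ s, matVec (A i) := by
  let φ : Mat d →+ EuclideanSpace ℝ (Fin d × Fin d) :=
    { toFun := matVec, map_zero' := rfl, map_add' := fun _ _ => rfl }
  exact map_sum φ A s

theorem inner_matVec_vecMulVec (A : Mat d) (a b : Vec d) :
    inner ℝ (matVec A) (matVec (Matrix.vecMulVec a.ofLp b.ofLp)) = ∑ j, a j * (A *ᵥ b.ofLp) j := by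
  rw [PiLp.inner_apply, Fintype.sum_prod_type]
  refine Finset.sum_congr rfl fun j _ => ?_
  rw [Matrix.mulVec, dotProduct, Finset.mul_sum]
  refine Finset.sum_congr rfl fun k _ => ?_
  simp [matVec, Matrix.vecMulVec_apply]
  ring

theorem norm_vecMulVec (a b : Vec d) : ‖Matrix.vecMulVec a.ofLp b.ofLp‖ = ‖a‖ * ‖b‖ := by
  rw [← sq_eq_sq₀ (norm_nonneg _) (by positivity), Matrix.frobenius_norm_sq, mul_pow,
    EuclideanSpace.real_norm_sq_eq, EuclideanSpace.real_norm_sq_eq, Finset.sum_mul_sum]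
  simp [Matrix.vecMulVec_apply, mul_pow]

theorem sq_mulVec_le (A : Mat d) (y : Vec d) : ∑ j, (A *ᵥ y.ofLp) j ^ 2 ≤ ‖A‖ ^ 2 * ‖y‖ ^ 2 := by
  rw [Matrix.frobenius_norm_sq, EuclideanSpace.real_norm_sq_eq, Finset.sum_mul]
  refine Finset.sum_le_sum fun j _ => ?_
  rw [Matrix.mulVec, dotProduct]
  exact Finset.sum_mul_sq_le_sq_mul_sq Finset.univ (fun k => A j k) (fun k => y.ofLp k)

/-- Projection onto the Frobenius ball is a contraction towards the points of the ball. -/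
theorem norm_nearestPoint_sub_le {W : ℝ} (A Q : Mat d) (hQ : ‖Q‖ ≤ W) :
    ‖nearestPoint {Θ : Mat d | ‖Θ‖ ≤ W} A‖ ≤ W ∧
      ‖nearestPoint {Θ : Mat d | ‖Θ‖ ≤ W} A - Q‖ ≤ ‖A - Q‖ := by
  have hproper : ProperSpace (Mat d) := FiniteDimensional.proper_real _
  have hclosed : IsClosed {Θ : Mat d | ‖Θ‖ ≤ W} := isClosed_le continuous_norm continuous_const
  obtain ⟨hp, hmin⟩ := nearestPoint_spec hclosed ⟨Q, hQ⟩ A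
  set p := nearestPoint {Θ : Mat d | ‖Θ‖ ≤ W} A
  refine ⟨hp, ?_⟩
  let S : Set (EuclideanSpace ℝ (Fin d × Fin d)) := Metric.closedBall 0 W
  have hpS : matVec p ∈ S := by
    rw [mem_closedBall_zero_iff, norm_matVec]; exact hp
  have hQS : matVec Q ∈ S := by
    rw [mem_closedBall_zero_iff, norm_matVec]; exact hQ
  have hle : ∀ w ∈ S, ‖matVec A - matVec p‖ ≤ ‖matVec A - w‖ := by
    intro w hw
    let w' : Mat d := Matrix.of fun i j => w (i, j)
    have hw' : matVec w' = w := rfl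
    rw [← hw', ← matVec_sub, ← matVec_sub, norm_matVec, norm_matVec]
    refine hmin w' ?_
    rw [mem_closedBall_zero_iff, ← hw', norm_matVec] at hw
    exact hw
  have hinf : ‖matVec A - matVec p‖ = ⨅ w : S, ‖matVec A - w‖ := by
    have : Nonempty S := ⟨⟨_, hQS⟩⟩
    refine le_antisymm (le_ciInf fun w => hle w w.2) ?_
    exact ciInf_le ⟨0, by rintro _ ⟨w, rfl⟩; exact norm_nonneg _⟩ (⟨_, hpS⟩ : S)
  -- The angle at the projection is obtuse, so expanding `‖A - Q‖²` around `p` leaves only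
  -- nonnegative terms besides `‖p - Q‖²`.
  have hobtuse := (norm_eq_iInf_iff_real_inner_le_zero (convex_closedBall 0 W) hpS).1 hinf _ hQS
  rw [← norm_matVec, ← norm_matVec, matVec_sub, matVec_sub]
  have h1 : ‖matVec A - matVec Q‖ ^ 2 = ‖matVec A - matVec p‖ ^ 2
      - 2 * inner ℝ (matVec A - matVec p) (matVec Q - matVec p)
      + ‖matVec p - matVec Q‖ ^ 2 := by
    rw [show matVec A - matVec Q = (matVec A - matVec p) - (matVec Q - matVec p) by abel,
      norm_sub_sq_real, norm_sub_rev (matVec Q) (matVec p)]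
  exact le_of_sq_le_sq (by nlinarith [sq_nonneg ‖matVec A - matVec p‖]) (norm_nonneg _)

end matVec

/-! ### Deterministic analysis of the descent. -/

section glmtron

variable {d n : ℕ} {σ : Fin d → ℝ → ℝ} {W R C : ℝ} {x e : ℕ → Vec d} {Θstar : Mat d}

theorem glmtron_succ (η : ℕ → ℝ) {t : ℕ} (ht : 1 ≤ t) :
    glmtron σ W n η x (t + 1) = nearestPoint {Θ : Mat d | ‖Θ‖ ≤ W}
      (glmtron σ W n η x t - η t • pseudoGrad σ n x (glmtron σ W n η x t)) := by
  obtain ⟨s, rfl⟩ := Nat.exists_eq_add_of_le' ht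
  rfl

theorem norm_glmtron_le (hW : ‖Θstar‖ ≤ W) (η : ℕ → ℝ) (t : ℕ) :
    ‖glmtron σ W n η x t‖ ≤ W := by
  have h0 : (0 : ℝ) ≤ W := (norm_nonneg _).trans hW
  match t with
  | 0 => simpa [glmtron] using h0
  | 1 => simpa [glmtron] using h0
  | t + 2 => exact (norm_nearestPoint_sub_le _ Θstar hW).1

theorem norm_glmtron_sub_le (hW : ‖Θstar‖ ≤ W) (η : ℕ → ℝ) (t : ℕ) :
    ‖glmtron σ W n η x t - Θstar‖ ≤ 2 * W := by
  have := norm_sub_le (glmtron σ W n η x t) Θstar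
  have := norm_glmtron_le (σ := σ) (n := n) (x := x) hW η t
  linarith

theorem norm_glm_sub_sq_le (hσ : IsLink σ) (Θ Θ' : Mat d) (y : Vec d) :
    ‖glm σ Θ y - glm σ Θ' y‖ ^ 2 ≤ ‖Θ - Θ'‖ ^ 2 * ‖y‖ ^ 2 := by
  refine le_trans ?_ (sq_mulVec_le _ _)
  rw [EuclideanSpace.real_norm_sq_eq]
  refine Finset.sum_le_sum fun j _ => ?_
  rw [Matrix.sub_mulVec]
  exact sq_le_sq.2 (hσ.abs_sub_le j _ _)

theorem predError_nonneg (Θ : Mat d) : 0 ≤ predError σ Θstar n x Θ := by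
  unfold predError; positivity

theorem predError_le (hσ : IsLink σ) (hn : 0 < n) (h : IsRegularTrajectory n x e R C) (Θ : Mat d) :
    predError σ Θstar n x Θ ≤ 8 * R * ‖Θ - Θstar‖ ^ 2 := by
  have hn' : (0 : ℝ) < n := by exact_mod_cast hn
  unfold predError
  rw [one_div_mul_eq_div, div_le_iff₀ hn']
  calc _ ≤ ∑ i ∈ Finset.Icc 1 n, ‖Θ - Θstar‖ ^ 2 * ‖x i‖ ^ 2 :=
        Finset.sum_le_sum fun i _ => norm_glm_sub_sq_le hσ _ _ _
    _ = ‖Θ - Θstar‖ ^ 2 * ∑ i ∈ Finset.Icc 1 n, ‖x i‖ ^ 2 := by rw [Finset.mul_sum]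
    _ ≤ ‖Θ - Θstar‖ ^ 2 * (8 * n * R) := by gcongr; exact h.energy
    _ = _ := by ring

/-- The prediction error controls the parameter error for expansive links. -/
theorem le_predError (hn : 0 < n) (h : IsRegularTrajectory n x e R C) {ζ : ℝ} (hζ : 0 < ζ)
    (hexp : ∀ (j : Fin d) (a b : ℝ), ζ * |a - b| ≤ |σ j a - σ j b|) (Θ : Mat d) :
    ζ ^ 2 / 32 * ‖Θ - Θstar‖ ^ 2 ≤ predError σ Θstar n x Θ := by
  have hn' : (0 : ℝ) < n := by exact_mod_cast hn
  have h1 : ∀ i, ζ ^ 2 * ∑ j, ((Θ - Θstar) *ᵥ (x i).ofLp) j ^ 2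
      ≤ ‖glm σ Θ (x i) - glm σ Θstar (x i)‖ ^ 2 := by
    intro i
    rw [EuclideanSpace.real_norm_sq_eq, Finset.mul_sum]
    refine Finset.sum_le_sum fun j _ => ?_
    rw [← mul_pow, Matrix.sub_mulVec]
    refine sq_le_sq.2 ?_
    rw [abs_mul, abs_of_pos hζ]
    exact hexp j _ _
  -- Excitation is applied to each row of `Θ - Θstar` separately.
  have h2 : ∀ j, n / 32 * ∑ k, (Θ - Θstar) j k ^ 2
      ≤ ∑ i ∈ Finset.Icc 1 n, ((Θ - Θstar) *ᵥ (x i).ofLp) j ^ 2 := by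
    intro j
    have := h.excitation (WithLp.toLp 2 fun k => (Θ - Θstar) j k)
    rw [EuclideanSpace.real_norm_sq_eq] at this
    refine this.trans (le_of_eq (Finset.sum_congr rfl fun i _ => ?_))
    rw [PiLp.inner_apply, Matrix.mulVec, dotProduct]
    simp
  unfold predError
  rw [one_div_mul_eq_div, le_div_iff₀ hn']
  calc ζ ^ 2 / 32 * ‖Θ - Θstar‖ ^ 2 * n
      = ζ ^ 2 * ∑ j, n / 32 * ∑ k, (Θ - Θstar) j k ^ 2 := by
        rw [← Finset.mul_sum, Matrix.frobenius_norm_sq]; ring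
    _ ≤ ζ ^ 2 * ∑ j, ∑ i ∈ Finset.Icc 1 n, ((Θ - Θstar) *ᵥ (x i).ofLp) j ^ 2 := by
        gcongr with j; exact h2 j
    _ = ∑ i ∈ Finset.Icc 1 n, ζ ^ 2 * ∑ j, ((Θ - Θstar) *ᵥ (x i).ofLp) j ^ 2 := by
        rw [Finset.sum_comm, Finset.mul_sum]
    _ ≤ _ := Finset.sum_le_sum fun i _ => h1 i

/-- One step of projected pseudogradient descent. -/
theorem norm_glmtron_succ_sub_sq_le (hσ : IsLink σ) (hn : 0 < n)
    (h : IsRegularTrajectory n x e R C) (hx : ∀ i, x (i + 1) = glm σ Θstar (x i) + e i)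
    (hW : ‖Θstar‖ ≤ W) {s μ : ℝ} (hs : 0 ≤ s) (hsR : 16 * R * s ≤ 1)
    (hμ : 0 ≤ μ) (hCμ : C ≤ n ^ 2 * μ ^ 2) {t : ℕ} (ht : 1 ≤ t) :
    ‖glmtron σ W n (fun _ => s) x (t + 1) - Θstar‖ ^ 2 ≤
      ‖glmtron σ W n (fun _ => s) x t - Θstar‖ ^ 2
      - s * predError σ Θstar n x (glmtron σ W n (fun _ => s) x t)
      + 2 * s * (‖glmtron σ W n (fun _ => s) x t - Θstar‖ * μ) + 2 * s ^ 2 * μ ^ 2 := by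
  have hn' : (0 : ℝ) < n := by exact_mod_cast hn
  rw [glmtron_succ _ ht]
  set Θ := glmtron σ W n (fun _ => s) x t with hΘ
  have hproj := (norm_nearestPoint_sub_le (Θ - s • pseudoGrad σ n x Θ) Θstar hW).2
  set E := predError σ Θstar n x Θ with hE
  set r : ℕ → Vec d := fun i => glm σ Θ (x i) - glm σ Θstar (x i) with hr
  have hE' : E = (1 / (n : ℝ)) * ∑ i ∈ Finset.Icc 1 n, ‖r i‖ ^ 2 := rfl
  set D := matVec (Θ - Θstar) with hD
  set G := matVec ((1 / (n : ℝ)) • ∑ i ∈ Finset.Icc 1 n,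
    Matrix.vecMulVec (r i).ofLp (x i).ofLp) with hG
  set M := matVec ((1 / (n : ℝ)) • ∑ i ∈ Finset.Icc 1 n,
    Matrix.vecMulVec (e i).ofLp (x i).ofLp) with hM
  have hgrad : matVec (pseudoGrad σ n x Θ) = G - M := by
    rw [hG, hM, ← matVec_sub, ← smul_sub, ← Finset.sum_sub_distrib, pseudoGrad]
    congr 2
    refine Finset.sum_congr rfl fun i _ => ?_
    rw [hx, ← Matrix.sub_vecMulVec]
    congr 1
    funext j
    simp only [hr, PiLp.sub_apply, PiLp.add_apply, Pi.sub_apply]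
    ring
  have hMμ : ‖M‖ ≤ μ := by
    rw [hM, norm_matVec, norm_smul, Real.norm_eq_abs, abs_of_pos (by positivity),
      one_div_mul_eq_div, div_le_iff₀ hn']
    refine le_of_sq_le_sq ?_ (by positivity)
    refine h.noise.trans (hCμ.trans (le_of_eq ?_))
    ring
  -- Cocoercivity of each `σ j`, summed over coordinates and samples, replaces convexity.
  have hDG : E ≤ inner ℝ D G := by
    rw [hE', hG, matVec_smul, matVec_sum, inner_smul_right, inner_sum]
    refine mul_le_mul_of_nonneg_left (Finset.sum_le_sum fun i _ => ?_) (by positivity)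
    rw [hD, inner_matVec_vecMulVec, EuclideanSpace.real_norm_sq_eq]
    refine Finset.sum_le_sum fun j _ => ?_
    rw [Matrix.sub_mulVec]
    exact hσ.sq_sub_le_mul j _ _
  have hGE : ‖G‖ ^ 2 ≤ 8 * R * E := by
    have h1 : ‖∑ i ∈ Finset.Icc 1 n, Matrix.vecMulVec (r i).ofLp (x i).ofLp‖
        ≤ ∑ i ∈ Finset.Icc 1 n, ‖r i‖ * ‖x i‖ :=
      (norm_sum_le _ _).trans (le_of_eq (Finset.sum_congr rfl fun i _ => norm_vecMulVec _ _))
    have h2 := Finset.sum_mul_sq_le_sq_mul_sq (Finset.Icc 1 n) (fun i => ‖r i‖) (fun i => ‖x i‖)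
    have h3 : ∑ i ∈ Finset.Icc 1 n, ‖r i‖ ^ 2 = n * E := by rw [hE']; field_simp
    rw [h3] at h2
    have hE0 : 0 ≤ E := predError_nonneg Θ
    rw [hG, norm_matVec, norm_smul, mul_pow, Real.norm_eq_abs, sq_abs, one_div, inv_pow,
      inv_mul_eq_div, div_le_iff₀ (by positivity)]
    calc _ ≤ (∑ i ∈ Finset.Icc 1 n, ‖r i‖ * ‖x i‖) ^ 2 := by gcongr
      _ ≤ n * E * ∑ i ∈ Finset.Icc 1 n, ‖x i‖ ^ 2 := h2
      _ ≤ n * E * (8 * n * R) := by gcongr; exact h.energy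
      _ = _ := by ring
  have hDM : inner ℝ D M ≤ ‖D‖ * μ :=
    (real_inner_le_norm _ _).trans (mul_le_mul_of_nonneg_left hMμ (norm_nonneg _))
  have hGM : ‖G - M‖ ^ 2 ≤ 2 * ‖G‖ ^ 2 + 2 * ‖M‖ ^ 2 := by
    have h1 := norm_sub_le G M
    have h2 : ‖G - M‖ ^ 2 ≤ (‖G‖ + ‖M‖) ^ 2 := by gcongr
    nlinarith [sq_nonneg (‖G‖ - ‖M‖)]
  have hM2 : ‖M‖ ^ 2 ≤ μ ^ 2 := by gcongr
  have hDn : ‖D‖ = ‖Θ - Θstar‖ := norm_matVec _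
  rw [← hDn]
  have h1 : ‖Θ - s • pseudoGrad σ n x Θ - Θstar‖ ^ 2
      = ‖D‖ ^ 2 - 2 * s * (inner ℝ D G - inner ℝ D M) + s ^ 2 * ‖G - M‖ ^ 2 := by
    rw [← norm_matVec, show Θ - s • pseudoGrad σ n x Θ - Θstar
      = (Θ - Θstar) - s • pseudoGrad σ n x Θ by abel, matVec_sub, matVec_smul, hgrad,
      norm_sub_sq_real, inner_smul_right, inner_sub_right, norm_smul, mul_pow, Real.norm_eq_abs,
      sq_abs]
    ring
  -- The step-size condition makes the second-order term use up only half of the descent `2sE`.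
  have h2 : s ^ 2 * ‖G - M‖ ^ 2 ≤ s * E + 2 * s ^ 2 * μ ^ 2 := by
    have hE0 : 0 ≤ E := predError_nonneg Θ
    calc s ^ 2 * ‖G - M‖ ^ 2 ≤ s ^ 2 * (2 * (8 * R * E) + 2 * μ ^ 2) := by
          gcongr; linarith
      _ = (16 * R * s) * (s * E) + 2 * s ^ 2 * μ ^ 2 := by ring
      _ ≤ 1 * (s * E) + 2 * s ^ 2 * μ ^ 2 := by gcongr
      _ = _ := by ring
  have h3 : 2 * s * (E - ‖D‖ * μ) ≤ 2 * s * (inner ℝ D G - inner ℝ D M) := by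
    gcongr
  calc _ ≤ ‖Θ - s • pseudoGrad σ n x Θ - Θstar‖ ^ 2 := by gcongr
    _ ≤ _ := by rw [h1]; linarith

/-- The one-step inequality telescopes from `Θ⁽¹⁾ = 0`, at distance at most `W`; in the noise term
the distance is bounded by the diameter `2W`. -/
theorem uniformIterateError_le (hσ : IsLink σ) (hn : 0 < n)
    (h : IsRegularTrajectory n x e R C) (hx : ∀ i, x (i + 1) = glm σ Θstar (x i) + e i)
    (hW : ‖Θstar‖ ≤ W) {s μ : ℝ} (hs : 0 < s) (hsR : 16 * R * s ≤ 1)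
    (hμ : 0 ≤ μ) (hCμ : C ≤ n ^ 2 * μ ^ 2) {m : ℕ} (hm : 1 ≤ m) :
    uniformIterateError σ Θstar W n (fun _ => s) x m ≤
      W ^ 2 / (s * m) + 4 * W * μ + 2 * s * μ ^ 2 := by
  have hm' : (0 : ℝ) < m := by exact_mod_cast hm
  have hW0 : 0 ≤ W := (norm_nonneg _).trans hW
  set T := glmtron σ W n (fun _ => s) x with hT
  have hsum : ∀ m : ℕ, s * ∑ t ∈ Finset.Icc 1 m, predError σ Θstar n x (T t)
      + ‖T (m + 1) - Θstar‖ ^ 2 ≤ W ^ 2 + m * (4 * s * W * μ + 2 * s ^ 2 * μ ^ 2) := by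
    intro m
    induction m with
    | zero =>
      have : T (0 + 1) = 0 := rfl
      rw [this]
      simp
      gcongr
    | succ m ih =>
      have h1 := norm_glmtron_succ_sub_sq_le hσ hn h hx hW hs.le hsR hμ hCμ
        (t := m + 1) (by omega)
      have h2 := norm_glmtron_sub_le (σ := σ) (n := n) (x := x) hW (fun _ => s) (m + 1)
      rw [← hT] at h1 h2
      have h3 : 2 * s * (‖T (m + 1) - Θstar‖ * μ) ≤ 2 * s * (2 * W * μ) := by gcongr
      rw [Finset.sum_Icc_succ_top (by omega)]
      push_cast
      linarith
  have h1 := hsum m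
  have h2 := sq_nonneg ‖T (m + 1) - Θstar‖
  unfold uniformIterateError
  rw [one_div_mul_eq_div, div_le_iff₀ hm']
  refine le_of_mul_le_mul_left (a := s) ?_ hs
  have h3 : s * ((W ^ 2 / (s * m) + 4 * W * μ + 2 * s * μ ^ 2) * m)
      = W ^ 2 + m * (4 * s * W * μ + 2 * s ^ 2 * μ ^ 2) := by
    field_simp
    ring
  rw [h3]
  linarith

theorem uniformIterateError_le_of_forall {B : ℝ} (η : ℕ → ℝ) {m : ℕ} (hm : 1 ≤ m)
    (hB : ∀ t, predError σ Θstar n x (glmtron σ W n η x t) ≤ B) :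
    uniformIterateError σ Θstar W n η x m ≤ B := by
  have hm' : (0 : ℝ) < m := by exact_mod_cast hm
  unfold uniformIterateError
  rw [one_div_mul_eq_div, div_le_iff₀ hm']
  refine (Finset.sum_le_sum fun t _ => hB t).trans (le_of_eq ?_)
  simp [mul_comm]

/-- Half of the descent `sζ²/32` absorbs the noise cross term by Young's inequality. The other half
is the contraction, against a forcing of `65 s μ²/ζ²`; the fixed point is `65 * 64 * μ²/ζ⁴`. -/
theorem norm_glmtron_sub_sq_le_of_expansive (hσ : IsLink σ) (hn : 0 < n)
    (h : IsRegularTrajectory n x e R C) (hx : ∀ i, x (i + 1) = glm σ Θstar (x i) + e i)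
    (hW : ‖Θstar‖ ≤ W) {ζ s μ : ℝ} (hζ : 0 < ζ) (hζ1 : ζ ≤ 1)
    (hexp : ∀ (j : Fin d) (a b : ℝ), ζ * |a - b| ≤ |σ j a - σ j b|)
    (hs : 0 < s) (hs1 : 2 * s ≤ 1) (hsR : 16 * R * s ≤ 1)
    (hμ : 0 ≤ μ) (hCμ : C ≤ n ^ 2 * μ ^ 2) (m : ℕ) :
    ‖glmtron σ W n (fun _ => s) x (m + 1) - Θstar‖ ^ 2 ≤
      (1 - s * ζ ^ 2 / 64) ^ m * W ^ 2 + 4160 * μ ^ 2 / ζ ^ 4 := by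
  have hW0 : 0 ≤ W := (norm_nonneg _).trans hW
  have hζ2 : ζ ^ 2 ≤ 1 := pow_le_one₀ hζ.le hζ1
  induction m with
  | zero =>
    have : glmtron σ W n (fun _ => s) x (0 + 1) = 0 := rfl
    rw [this, zero_sub, norm_neg, pow_zero, one_mul]
    have h1 : ‖Θstar‖ ^ 2 ≤ W ^ 2 := by gcongr
    have h2 : 0 ≤ 4160 * μ ^ 2 / ζ ^ 4 := by positivity
    linarith
  | succ m ih =>
    have h1 := norm_glmtron_succ_sub_sq_le hσ hn h hx hW hs.le hsR hμ hCμ (t := m + 1) (by omega)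
    set D := ‖glmtron σ W n (fun _ => s) x (m + 1) - Θstar‖ with hD
    have h2 := le_predError (Θstar := Θstar) hn h hζ hexp (glmtron σ W n (fun _ => s) x (m + 1))
    rw [← hD] at h2
    have h3 : 2 * (D * μ) ≤ ζ ^ 2 / 64 * D ^ 2 + 64 * μ ^ 2 / ζ ^ 2 := by
      have h4 : ζ ^ 2 / 64 * D ^ 2 + 64 * μ ^ 2 / ζ ^ 2 - 2 * (D * μ)
          = (ζ * D / 8 - 8 * μ / ζ) ^ 2 := by field_simp; ring
      linarith [sq_nonneg (ζ * D / 8 - 8 * μ / ζ)]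
    have h5 : 2 * s * μ ^ 2 ≤ μ ^ 2 / ζ ^ 2 := by
      rw [le_div_iff₀ (by positivity)]
      calc 2 * s * μ ^ 2 * ζ ^ 2 ≤ 1 * μ ^ 2 * 1 := by gcongr
        _ = μ ^ 2 := by ring
    have h6 := mul_le_mul_of_nonneg_left h2 hs.le
    have h7 := mul_le_mul_of_nonneg_left h3 hs.le
    have h8 := mul_le_mul_of_nonneg_left h5 hs.le
    have ha : 0 ≤ 1 - s * ζ ^ 2 / 64 := by nlinarith
    have h9 := mul_le_mul_of_nonneg_left ih ha
    have h10 : (1 - s * ζ ^ 2 / 64) * (4160 * μ ^ 2 / ζ ^ 4)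
        = 4160 * μ ^ 2 / ζ ^ 4 - 65 * (s * (μ ^ 2 / ζ ^ 2)) := by field_simp; ring
    have h11 : s * (ζ ^ 2 / 64 * D ^ 2 + 64 * μ ^ 2 / ζ ^ 2)
        = s * ζ ^ 2 / 64 * D ^ 2 + 64 * (s * (μ ^ 2 / ζ ^ 2)) := by ring
    have h12 : (1 - s * ζ ^ 2 / 64) ^ (m + 1) * W ^ 2
        = (1 - s * ζ ^ 2 / 64) * ((1 - s * ζ ^ 2 / 64) ^ m * W ^ 2) := by ring
    rw [mul_add, h10] at h9
    rw [h11] at h7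
    calc _ ≤ _ := h1
      _ ≤ (1 - s * ζ ^ 2 / 64) * D ^ 2 + 65 * (s * (μ ^ 2 / ζ ^ 2)) := by linarith
      _ ≤ _ := by linarith

end glmtron

/-! ### The two rates. -/

/-- Only monotonicity and subadditivity are used, so neither event has to be measurable. -/
theorem one_sub_le_measureReal {Ω : Type*} [MeasurableSpace Ω] {P : Measure Ω}
    [IsProbabilityMeasure P] {δ : ℝ} (hδ : 0 ≤ δ) {p q : Ω → Prop}
    (hp : P {ω | ¬ p ω} ≤ ENNReal.ofReal δ) (hpq : ∀ ω, p ω → q ω) :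
    1 - δ ≤ P.real {ω | q ω} := by
  have h1 : P.real {ω | ¬ p ω} ≤ δ := ENNReal.toReal_le_of_le_ofReal hδ hp
  have h2 : (Set.univ : Set Ω) ⊆ {ω | q ω} ∪ {ω | ¬ p ω} := fun ω _ => by
    by_cases h : p ω
    · exact Or.inl (hpq ω h)
    · exact Or.inr h
  have h3 := (measureReal_mono (μ := P) h2).trans (measureReal_union_le _ _)
  rw [probReal_univ] at h3
  linarith

theorem error_le_of_sq_le {R ζ u v D : ℝ} (hR : 1 ≤ R) (hζ : 0 < ζ) (hζ1 : ζ ≤ 1) (hu : 0 ≤ u)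
    (huv : u ≤ v) (hD : D ≤ 15000000 * (u / ζ ^ 4)) :
    8 * R * D ≤ 15000000 * ((4 * R) ^ 2 / ζ ^ 6) * v ∧ D ≤ 15000000 * (1 / ζ ^ 4) * v := by
  have h1 : 8 * R / ζ ^ 4 ≤ (4 * R) ^ 2 / ζ ^ 6 := by
    have h2 : ζ ^ 6 ≤ ζ ^ 4 := pow_le_pow_of_le_one hζ.le hζ1 (by norm_num)
    have h3 : 8 * R ≤ (4 * R) ^ 2 := by nlinarith
    exact div_le_div₀ (by positivity) h3 (by positivity) h2
  constructor
  · calc 8 * R * D ≤ 8 * R * (15000000 * (u / ζ ^ 4)) := by gcongr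
      _ = 15000000 * (8 * R / ζ ^ 4) * u := by ring
      _ ≤ 15000000 * ((4 * R) ^ 2 / ζ ^ 6) * v := by gcongr
  · calc D ≤ 15000000 * (1 / ζ ^ 4) * u := hD.trans (le_of_eq (by ring))
      _ ≤ 15000000 * (1 / ζ ^ 4) * v := by gcongr

section rates

variable {d n : ℕ} {σ : Fin d → ℝ → ℝ} {W R C U : ℝ} {x e : ℕ → Vec d} {Θstar : Mat d}

/-- Slow rate on a regular trajectory, where `59 * U` dominates the noise correlation. -/
theorem uniformIterateError_le_of_isRegularTrajectory (hσ : IsLink σ) (hn : 0 < n) (hR : 1 ≤ R)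
    (h : IsRegularTrajectory n x e R C) (hx : ∀ i, x (i + 1) = glm σ Θstar (x i) + e i)
    (hW : ‖Θstar‖ ≤ W) (hU : 0 < U) (hCU : C ≤ n ^ 2 * (59 * U) ^ 2) {m : ℕ} (hm : 1 ≤ m)
    (hmU : W * R ≤ U * m) :
    uniformIterateError σ Θstar W n (fun _ => 1 / (16 * R)) x m ≤ 2000 * (W * U) := by
  have hW0 : 0 ≤ W := (norm_nonneg _).trans hW
  have hm' : (0 : ℝ) < m := by exact_mod_cast hm
  have hWU : 0 ≤ W * U := by positivity
  -- If the noise level is below `W * R`, the term `2sμ²` is of order `W * U`. Otherwise the crude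
  -- bound `32RW²`, valid for every iterate, is already of that order.
  rcases le_total (59 * U) (W * R) with hc | hc
  · have h1 := uniformIterateError_le hσ hn h hx hW (s := 1 / (16 * R)) (μ := 59 * U)
      (by positivity) (le_of_eq (by field_simp)) (by positivity) hCU hm
    refine h1.trans ?_
    have h2 : W ^ 2 / (1 / (16 * R) * m) ≤ 16 * (W * U) := by
      rw [div_le_iff₀ (by positivity)]
      have : 16 * (W * U) * (1 / (16 * R) * m) = W * (U * m) / R := by field_simp
      rw [this, le_div_iff₀ (by positivity)]
      nlinarith
    have h3 : 2 * (1 / (16 * R)) * (59 * U) ^ 2 ≤ 59 / 8 * (W * U) := by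
      have : 2 * (1 / (16 * R)) * (59 * U) ^ 2 = 59 / 8 * (U * (59 * U) / R) := by
        field_simp; ring
      rw [this]
      gcongr
      rw [div_le_iff₀ (by positivity)]
      nlinarith
    linarith
  · refine uniformIterateError_le_of_forall _ hm fun t => ?_
    refine (predError_le hσ hn h _).trans ?_
    have h1 := norm_glmtron_sub_le (σ := σ) (n := n) (x := x) hW (fun _ => 1 / (16 * R)) t
    calc _ ≤ 8 * R * (2 * W) ^ 2 := by gcongr
      _ = 32 * W * (W * R) := by ring
      _ ≤ 32 * W * (59 * U) := by gcongr
      _ ≤ 2000 * (W * U) := by linarith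

/-- Fast rate on a regular trajectory, where `59 * U` dominates the noise correlation. -/
theorem norm_glmtron_sub_sq_le_of_isRegularTrajectory (hσ : IsLink σ) (hn : 0 < n) (hR : 1 ≤ R)
    (h : IsRegularTrajectory n x e R C) (hx : ∀ i, x (i + 1) = glm σ Θstar (x i) + e i)
    (hW : ‖Θstar‖ ≤ W) (hU : 0 < U) (hCU : C ≤ n ^ 2 * (59 * U) ^ 2) {ζ : ℝ} (hζ : 0 < ζ)
    (hζ1 : ζ ≤ 1) (hexp : ∀ (j : Fin d) (a b : ℝ), ζ * |a - b| ≤ |σ j a - σ j b|) {A : ℝ}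
    (hA : 0 < A) (hAU : 1 ≤ A * U ^ 2) {m : ℕ} (hm : 1 ≤ m)
    (hmA : 16384 * R ^ 2 / ζ ^ 4 * Real.log (1 + W ^ 2 * A) ≤ m) :
    ‖glmtron σ W n (fun _ => ζ ^ 2 / (16 * R) ^ 2) x m - Θstar‖ ^ 2 ≤ 15000000 * (U ^ 2 / ζ ^ 4) := by
  -- The `m`-th iterate has undergone only `m - 1` steps; the missing one costs the factor `exp a ≤
  -- 3` below.
  obtain ⟨k, rfl⟩ := Nat.exists_eq_add_of_le' hm
  have hζ2 : ζ ^ 2 ≤ 1 := pow_le_one₀ hζ.le hζ1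
  have hζ4 : ζ ^ 4 ≤ 1 := pow_le_one₀ hζ.le hζ1
  have hs1 : ζ ^ 2 / (16 * R) ^ 2 ≤ 1 / (16 * R) := by
    rw [div_le_div_iff₀ (by positivity) (by positivity)]
    nlinarith
  have hs2 : 1 / (16 * R) ≤ 1 / 16 := by
    gcongr
    linarith
  have h1 := norm_glmtron_sub_sq_le_of_expansive hσ hn h hx hW hζ hζ1 hexp
    (s := ζ ^ 2 / (16 * R) ^ 2) (μ := 59 * U) (by positivity) (by linarith)
    (by
      calc 16 * R * (ζ ^ 2 / (16 * R) ^ 2) ≤ 16 * R * (1 / (16 * R)) := by gcongr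
        _ = 1 := by field_simp) (by positivity) hCU k
  refine h1.trans ?_
  set a : ℝ := ζ ^ 4 / (16384 * R ^ 2) with ha
  have ha0 : 0 < a := by positivity
  have ha1 : a ≤ 1 := by
    rw [ha, div_le_one (by positivity)]
    nlinarith
  have hsa : ζ ^ 2 / (16 * R) ^ 2 * ζ ^ 2 / 64 = a := by rw [ha]; field_simp; norm_num
  rw [hsa]
  have hlog : Real.log (1 + W ^ 2 * A) ≤ a * (k + 1) := by
    push_cast at hmA
    have h2 := mul_le_mul_of_nonneg_left hmA ha0.le
    refine le_trans (le_of_eq ?_) h2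
    rw [ha]; field_simp
  have hpos : 0 < 1 + W ^ 2 * A := by positivity
  have hdecay : (1 - a) ^ k ≤ 3 / (1 + W ^ 2 * A) := by
    have h2 : (1 - a) ^ k ≤ Real.exp (-a) ^ k := by
      refine pow_le_pow_left₀ (by linarith) ?_ k
      have := Real.add_one_le_exp (-a)
      linarith
    refine h2.trans ?_
    rw [← Real.exp_nat_mul, show (k : ℝ) * -a = a - a * (k + 1) by ring, Real.exp_sub]
    have h3 : Real.exp a ≤ 3 := (Real.exp_le_exp.2 ha1).trans Real.exp_one_lt_three.le
    have h4 : 1 + W ^ 2 * A ≤ Real.exp (a * (k + 1)) := by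
      rw [← Real.log_le_iff_le_exp hpos]; exact hlog
    gcongr
  -- The initial error is forgotten down to the noise level: `W²/(1 + W²A) ≤ 1/A ≤ U²`.
  have hinit : (1 - a) ^ k * W ^ 2 ≤ 3 * (U ^ 2 / ζ ^ 4) := by
    calc (1 - a) ^ k * W ^ 2 ≤ 3 / (1 + W ^ 2 * A) * W ^ 2 := by gcongr
      _ = 3 * (W ^ 2 / (1 + W ^ 2 * A)) := by ring
      _ ≤ 3 * U ^ 2 := by
        gcongr
        rw [div_le_iff₀ hpos]
        nlinarith [mul_nonneg (sq_nonneg W) (sub_nonneg.2 hAU), sq_nonneg U]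
      _ ≤ 3 * (U ^ 2 / ζ ^ 4) := by
        gcongr
        rw [le_div_iff₀ (by positivity)]
        nlinarith [sq_nonneg U]
  have hnoise : 4160 * (59 * U) ^ 2 / ζ ^ 4 = 14480960 * (U ^ 2 / ζ ^ 4) := by ring
  have h5 : 0 ≤ U ^ 2 / ζ ^ 4 := by positivity
  rw [hnoise]
  linarith

end rates

theorem theorem2 :
    ∃ c : ℝ, 0 < c ∧
      ∀ {Ω : Type*} [MeasurableSpace Ω] (P : Measure Ω) [IsProbabilityMeasure P]
        (d n : ℕ) (_ : 0 < d)
        (σ : Fin d → ℝ → ℝ) (Θstar K : Mat d) (ρ τ W δ R B : ℝ)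
        (ε : ℕ → Ω → Vec d) (x : Ω → ℕ → Vec d),
        0 < δ →
        IsNoise P n ε τ →
        IsLink σ →
        IsDiagLyapunov Θstar K ρ →
        ‖Θstar‖ ≤ W →
        (∀ ω, x ω = trajectory (glm σ Θstar) (fun i => ε i ω)) →
        R = effRadius K ρ →
        B = 4 * R →
        c * (τ ^ 4 * d / (1 - ρ)) * Real.log (R / δ + 1) ≤ n →
        -- slow rate
        (∀ m : ℕ, 1 ≤ m →
          c * (W * B / √(τ ^ 2 * d * R * Real.log (4 * R / δ + 1))) * √(n : ℝ) ≤ m →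
          1 - δ ≤ P.real {ω |
            uniformIterateError σ Θstar W n (fun _ => 1 / (16 * R)) (x ω) m ≤
              c * (τ * W * √(sigmaMax K / (1 - ρ))) *
                √((d : ℝ) ^ 2 / n * Real.log (4 * R / δ + 1))}) ∧
        -- fast rate
        (∀ ζ : ℝ, 0 < ζ →
          (∀ (j : Fin d) (a b : ℝ), ζ * |a - b| ≤ |σ j a - σ j b|) →
          ∀ m : ℕ, 1 ≤ m →
          c * (B ^ 2 / ζ ^ 4) * Real.log (1 + n * W ^ 2 * B ^ 2 / (τ ^ 2 * R)) ≤ m →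
          1 - δ ≤ P.real {ω |
            predError σ Θstar n (x ω)
                (glmtron σ W n (fun _ => ζ ^ 2 / (16 * R) ^ 2) (x ω) m) ≤
              c * (τ ^ 2 * B ^ 2 / ζ ^ 6 * (sigmaMax K / (1 - ρ))) *
                ((d : ℝ) ^ 2 / n * Real.log (4 * R / δ + 1)) ∧
            ‖glmtron σ W n (fun _ => ζ ^ 2 / (16 * R) ^ 2) (x ω) m - Θstar‖ ^ 2 ≤
              c * (τ ^ 2 / ζ ^ 4 * (sigmaMax K / (1 - ρ))) *
                ((d : ℝ) ^ 2 / n * Real.log (4 * R / δ + 1))}) := by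
  -- The largest demand on the constant is `4160 * 59² + 3` from the fast rate.
  refine ⟨15000000, by norm_num, ?_⟩
  intro Ω _ P _ d n hd σ Θstar K ρ τ W δ R B ε x hδ hε hσ hK hW hx hR hB hn
  rcases le_or_gt 1 δ with hδ1 | hδ1
  · exact ⟨fun m _ _ => (by linarith : 1 - δ ≤ 0).trans measureReal_nonneg,
      fun ζ _ _ m _ _ => (by linarith : 1 - δ ≤ 0).trans measureReal_nonneg⟩
  obtain ⟨hτ, hτ1⟩ := hε.pos_and_one_le_two_mul_sq hd
  have hρ := hK.rho_lt_one
  have hρ0 : 0 < 1 - ρ := by linarith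
  have hd1 : (1 : ℝ) ≤ d := by exact_mod_cast hd
  have hdR : (d : ℝ) ≤ R := hR ▸ hK.card_le_trace.trans hK.trace_le_effRadius
  have hR1 : 1 ≤ R := hd1.trans hdR
  set l := Real.log (R / δ + 1) with hl
  set L := Real.log (4 * R / δ + 1) with hL
  have hRδ : 1 < R / δ := by rw [lt_div_iff₀ hδ]; linarith
  have hl0 : 0 < l := Real.log_pos (by linarith)
  have h4R : 4 * R / δ = 4 * (R / δ) := by ring
  have hlL : l ≤ L := Real.log_le_log (by linarith) (by rw [h4R]; linarith)
  -- As `R/δ > 1`, the factor `4` inside the logarithm pushes its argument beyond `e`.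
  have hL1 : 1 ≤ L := by
    rw [hL, Real.le_log_iff_exp_le (by rw [h4R]; linarith), h4R]
    have := Real.exp_one_lt_three
    linarith
  have hn1 : 15000000 * (τ ^ 4 * d * l) ≤ n * (1 - ρ) := by
    have : 15000000 * (τ ^ 4 * d / (1 - ρ)) * l = 15000000 * (τ ^ 4 * d * l) / (1 - ρ) := by ring
    rwa [this, div_le_iff₀ hρ0] at hn
  have hτdl : 0 < τ ^ 4 * d * l := by positivity
  have hn' : (0 : ℝ) < n := by
    by_contra hcon
    nlinarith
  have hn0 : 0 < n := by exact_mod_cast hn'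
  have hreg := hε.measure_not_isRegularTrajectory_le hσ hK hd hδ hδ1 (l := l) (by rw [hl, hR])
    (by linarith)
  rw [← hR] at hreg
  set C := 3456 * τ ^ 2 * d * R * l * n with hC
  set U := √(τ ^ 2 * d * R * L / n) with hU
  have hU0 : 0 < U := Real.sqrt_pos.2 (by positivity)
  have hUsq : U ^ 2 = τ ^ 2 * d * R * L / n := Real.sq_sqrt (by positivity)
  -- `59` is the least integer whose square exceeds `3456`.
  have hCU : C ≤ n ^ 2 * (59 * U) ^ 2 := by
    have : (n : ℝ) ^ 2 * (59 * U) ^ 2 = 3481 * (τ ^ 2 * d * R * L * n) := by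
      rw [mul_pow, hUsq]; field_simp; norm_num
    rw [this, hC]
    have h1 : τ ^ 2 * d * R * l * n ≤ τ ^ 2 * d * R * L * n := by gcongr
    have h2 : 0 ≤ τ ^ 2 * d * R * L * n := by positivity
    linarith
  have hUK : U ^ 2 ≤ τ ^ 2 * (sigmaMax K / (1 - ρ)) * ((d : ℝ) ^ 2 / n * L) := by
    have h1 := hK.card_mul_effRadius_le
    rw [← hR] at h1
    calc U ^ 2 = τ ^ 2 * (L / n) * (d * R) := by rw [hUsq]; ring
      _ ≤ τ ^ 2 * (L / n) * (d ^ 2 * (sigmaMax K / (1 - ρ))) := by gcongr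
      _ = _ := by ring
  have hsK : 0 ≤ sigmaMax K / (1 - ρ) := div_nonneg (norm_nonneg _) hρ0.le
  have hxs : ∀ ω i, x ω (i + 1) = glm σ Θstar (x ω i) + ε i ω := by
    intro ω i
    rw [hx]; rfl
  have hW0 : 0 ≤ W := (norm_nonneg _).trans hW
  refine ⟨fun m hm hmn => ?_, fun ζ hζ hexp m hm hmn => ?_⟩
  · refine one_sub_le_measureReal hδ.le hreg fun ω hω => ?_
    rw [← hx] at hω
    have hsqrt : √(τ ^ 2 * d * R * L) = U * √n := by
      rw [hU, ← Real.sqrt_mul (by positivity)]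
      congr 1
      field_simp
    have hmU : W * R ≤ U * m := by
      have hsn : 0 < √(n : ℝ) := Real.sqrt_pos.2 hn'
      rw [hsqrt, hB] at hmn
      have e1 : 15000000 * (W * (4 * R) / (U * √n)) * √n = 60000000 * (W * R) / U := by
        field_simp; ring
      rw [e1, div_le_iff₀ hU0] at hmn
      have : 0 ≤ W * R := by positivity
      linarith
    refine (uniformIterateError_le_of_isRegularTrajectory hσ hn0 hR1 hω (hxs ω) hW hU0 hCU hm
      hmU).trans ?_
    have h1 : U ≤ τ * √(sigmaMax K / (1 - ρ)) * √((d : ℝ) ^ 2 / n * L) := by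
      refine le_of_sq_le_sq ?_ (by positivity)
      rw [mul_pow (τ * _), mul_pow τ, Real.sq_sqrt hsK,
        Real.sq_sqrt (by positivity : 0 ≤ (d : ℝ) ^ 2 / n * L)]
      exact hUK
    calc 2000 * (W * U) ≤ 15000000 * (W * U) := by
          have : 0 ≤ W * U := by positivity
          linarith
      _ ≤ 15000000 * (W * (τ * √(sigmaMax K / (1 - ρ)) * √((d : ℝ) ^ 2 / n * L))) := by gcongr
      _ = _ := by ring
  · refine one_sub_le_measureReal hδ.le hreg fun ω hω => ?_
    rw [← hx] at hω
    -- Expansion by `ζ` is compatible with the `1`-Lipschitz bound only for `ζ ≤ 1`.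
    have hζ1 : ζ ≤ 1 := by
      have h1 := (hexp ⟨0, hd⟩ 1 0).trans (hσ.abs_sub_le _ _ _)
      simpa using h1
    have hA : (0 : ℝ) < n * B ^ 2 / (τ ^ 2 * R) := by
      rw [hB]; positivity
    have hAU : 1 ≤ n * B ^ 2 / (τ ^ 2 * R) * U ^ 2 := by
      have : n * B ^ 2 / (τ ^ 2 * R) * U ^ 2 = 16 * R ^ 2 * (d * L) := by
        rw [hUsq, hB]; field_simp; norm_num
      rw [this]
      have h1 : 1 ≤ d * L := one_le_mul_of_one_le_of_one_le hd1 hL1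
      nlinarith
    have hlogeq : 1 + n * W ^ 2 * B ^ 2 / (τ ^ 2 * R)
        = 1 + W ^ 2 * (n * B ^ 2 / (τ ^ 2 * R)) := by ring
    rw [hlogeq] at hmn
    have hlog0 : 0 ≤ Real.log (1 + W ^ 2 * (n * B ^ 2 / (τ ^ 2 * R))) :=
      Real.log_nonneg (by have : 0 ≤ W ^ 2 * (n * B ^ 2 / (τ ^ 2 * R)) := by positivity
                          linarith)
    have hmA : 16384 * R ^ 2 / ζ ^ 4 * Real.log (1 + W ^ 2 * (n * B ^ 2 / (τ ^ 2 * R))) ≤ m := by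
      refine le_trans ?_ hmn
      gcongr
      rw [hB]
      have : 15000000 * ((4 * R) ^ 2 / ζ ^ 4) = 240000000 * R ^ 2 / ζ ^ 4 := by ring
      rw [this]
      gcongr
      norm_num
    have hmain := norm_glmtron_sub_sq_le_of_isRegularTrajectory hσ hn0 hR1 hω (hxs ω) hW hU0 hCU hζ
      hζ1 hexp hA hAU hm hmA
    obtain ⟨h1, h2⟩ := error_le_of_sq_le hR1 hζ hζ1 (sq_nonneg U) hUK hmain
    refine ⟨(predError_le hσ hn0 hω _).trans (h1.trans (le_of_eq ?_)), h2.trans (le_of_eq ?_)⟩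
    · rw [hB]; ring
    · ring
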